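/- Let $s\ge 2$ be an integer, let $\mathbb Z_s=\varprojlim \mathbb Z/s^n\mathbb Z$ be the ring of $s$-adic integers with its profinite topology, and let $\mathcal V=\{(n,x): n\ge 0,\ 0\le x<s^n\}$. On $H=\ell^2(\mathcal V)$ with canonical basis $E_{(n,x)}$ let $V E_{(n,x)}=E_{(n+1,sx)}$ and, for $f\in C(\mathbb Z_s)$, $M_fE_{(n,x)}=f(x)E_{(n,x)}$; let $A_V=C^*(V,M_f\mid f\in C(\mathbb Z_s))\subseteq B(H)$. Let $P_{(0,0)}$ be the orthogonal projection onto $\mathbb C E_{(0,0)}$, let $I_V=C^*(V^nP_{(0,0)}V^{*n}\mid n\ge 0)$ and $\mathcal I_V=C^*(aV^n\mid a\in I_V,\ n\ge 0)$. Let $\mathfrak a_V$ be the endomorphism of $C(\mathbb Z_s)$ with $(\mathfrak a_Vf)(x)=f(x/s)$ if $s\mid x$ and $(\mathfrak a_Vf)(x)=0$ otherwise. Let $\mathrm{HS}(s)=C(\mathbb Z_s)\rtimes_{\mathfrak a_V}\mathbb N$ be the Hensel--Steinitz algebra: the universal unital $C^*$-algebra generated by a (unital) copy of $C(\mathbb Z_s)$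 and an isometry $v$ with $vfv^*=\mathfrak a_V(f)$ for all $f\in C(\mathbb Z_s)$. Let $\mathcal K$ be the $C^*$-algebra of compact operators on $\ell^2(\mathbb Z_{\ge 0})$, with matrix units $e_{kl}$. Then there is a short exact sequence of $C^*$-algebras $$0\longrightarrow \mathcal K\xrightarrow{\ \varphi\ } A_V\xrightarrow{\ \psi\ }\mathrm{HS}(s)\longrightarrow 0,$$ that is, $\varphi$ is an injective $*$-homomorphism, $\psi$ is a surjective $*$-homomorphism, and the range of $\varphi$ is the kernel of $\psi$. The maps can be chosen so that, moreover, $\psi(M_f)=f$ for all $f\in C(\mathbb Z_s)$ and $\psi(V)=v$, the range of $\varphi$ is $\mathcal I_V$, $\mathcal I_V$ is the $C^*$-algebra generated by the operators $V^kP_{(0,0)}V^{*l}$ $(k,l\ge 0)$, and $\varphi(e_{kl})=V^kP_{(0,0)}V^{*l}$ for all $k,l\ge 0$. -/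

import Mathlib

open scoped ENNReal lp

noncomputable section

namespace HenselShift

/-! ### The ring of `s`-adic integers -/

/-- The ring `ℤ_s = lim ℤ/sⁿℤ` of `s`-adic integers, as a subring of `∏ₙ ℤ/sⁿℤ`:
the coherent sequences. -/
def sAdicSubring (s : ℕ) : Subring (∀ n : ℕ, ZMod (s ^ n)) where
  carrier := {x | ∀ n, ZMod.castHom (pow_dvd_pow s n.le_succ) (ZMod (s ^ n)) (x (n + 1)) = x n}
  mul_mem' := by
    intro a b ha hb n
    simp only [Pi.mul_apply, map_mul, ha n, hb n]
  one_mem' := by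
    intro n
    simp only [Pi.one_apply, map_one]
  add_mem' := by
    intro a b ha hb n
    simp only [Pi.add_apply, map_add, ha n, hb n]
  zero_mem' := by
    intro n
    simp only [Pi.zero_apply, map_zero]
  neg_mem' := by
    intro a ha n
    simp only [Pi.neg_apply, map_neg, ha n]

/-- `ℤ_s`, with its ring structure and the profinite topology (the subspace topology of the product
of the finite discrete rings `ℤ/sⁿℤ`). -/
abbrev SAdicInt (s : ℕ) : Type := sAdicSubring s

theorem isClosed_sAdicSubring (s : ℕ) :
    IsClosed (sAdicSubring s : Set (∀ n : ℕ, ZMod (s ^ n))) := by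
  have h : (sAdicSubring s : Set (∀ n : ℕ, ZMod (s ^ n))) =
      ⋂ n, {x | ZMod.castHom (pow_dvd_pow s n.le_succ) (ZMod (s ^ n)) (x (n + 1)) = x n} := by
    ext x
    simp only [Set.mem_iInter]
    rfl
  rw [h]
  refine isClosed_iInter fun n => isClosed_eq ?_ (continuous_apply n)
  exact continuous_of_discreteTopology.comp (continuous_apply (n + 1))

instance compactSpace_sAdicInt (s : ℕ) [NeZero s] : CompactSpace (SAdicInt s) :=
  isCompact_iff_compactSpace.mp (isClosed_sAdicSubring s).isCompact

/-- Multiplication by `s` on `ℤ_s`. -/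
def mulS (s : ℕ) (x : SAdicInt s) : SAdicInt s := (s : SAdicInt s) * x

theorem continuous_mulS (s : ℕ) : Continuous (mulS s) := by
  have : Continuous fun x : SAdicInt s => fun n => (s : ZMod (s ^ n)) * (x : ∀ n, ZMod (s ^ n)) n :=
    continuous_pi fun n =>
      continuous_of_discreteTopology.comp ((continuous_apply n).comp continuous_subtype_val)
  exact Continuous.subtype_mk this _

theorem mulS_coe (s : ℕ) (x : SAdicInt s) (n : ℕ) :
    (mulS s x).1 n = (s : ZMod (s ^ n)) * x.1 n := rfl

theorem mulS_injective (s : ℕ) [NeZero s] : Function.Injective (mulS s) := by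
  intro x y hxy
  apply Subtype.ext
  funext n
  have h1 : (s : ZMod (s ^ (n + 1))) * (x.1 (n + 1) - y.1 (n + 1)) = 0 := by
    rw [mul_sub, ← mulS_coe, ← mulS_coe, hxy, sub_self]
  rw [← x.2 n, ← y.2 n, ← sub_eq_zero, ← map_sub]
  generalize x.1 (n + 1) - y.1 (n + 1) = d at h1
  obtain ⟨k, rfl⟩ := ZMod.natCast_zmod_surjective d
  rw [← Nat.cast_mul, ZMod.natCast_eq_zero_iff, pow_succ'] at h1
  rw [map_natCast, ZMod.natCast_eq_zero_iff]
  exact Nat.dvd_of_mul_dvd_mul_left (Nat.pos_of_ne_zero (NeZero.ne s)) h1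

theorem coe_val (s : ℕ) [NeZero s] (x : SAdicInt s) (n : ℕ) :
    (((x.1 (n + 1)).val : ℕ) : ZMod (s ^ n)) = x.1 n := by
  rw [← x.2 n, ← map_natCast (ZMod.castHom (pow_dvd_pow s n.le_succ) (ZMod (s ^ n))),
    ZMod.natCast_zmod_val]

theorem val_succ_mod (s : ℕ) [NeZero s] (x : SAdicInt s) (n : ℕ) :
    (x.1 (n + 1)).val % s ^ n = (x.1 n).val := by
  rw [← coe_val s x n, ZMod.val_natCast]

theorem dvd_val (s : ℕ) [NeZero s] (x : SAdicInt s) (hx : x.1 1 = 0) (n : ℕ) :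
    s ∣ (x.1 (n + 1)).val := by
  induction n with
  | zero =>
    have : x.1 (0 + 1) = 0 := hx
    rw [this, ZMod.val_zero]
    exact dvd_zero s
  | succ n ih =>
    rw [← val_succ_mod s x (n + 1)] at ih
    exact (Nat.dvd_mod_iff (dvd_pow_self s n.succ_ne_zero)).mp ih

theorem range_mulS (s : ℕ) [NeZero s] : Set.range (mulS s) = {x | x.1 1 = 0} := by
  ext x
  constructor
  · rintro ⟨y, rfl⟩
    have h : ((s : ℕ) : ZMod (s ^ 1)) = 0 := by
      rw [ZMod.natCast_eq_zero_iff, pow_one]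
    change (mulS s y).1 1 = 0
    rw [mulS_coe, h, zero_mul]
  · intro hx
    refine ⟨⟨fun n => (((x.1 (n + 1)).val / s : ℕ) : ZMod (s ^ n)), ?_⟩, ?_⟩
    · intro n
      rw [map_natCast, ZMod.natCast_eq_natCast_iff, Nat.ModEq]
      have h := val_succ_mod s x (n + 1)
      rw [← h, pow_succ' s n, Nat.mod_mul_right_div_self, Nat.mod_mod]
    · apply Subtype.ext
      funext n
      rw [mulS_coe]
      change (s : ZMod (s ^ n)) * (((x.1 (n + 1)).val / s : ℕ) : ZMod (s ^ n)) = x.1 n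
      rw [← Nat.cast_mul, Nat.mul_div_cancel' (dvd_val s x hx n), coe_val]

theorem isOpenEmbedding_mulS (s : ℕ) [NeZero s] : Topology.IsOpenEmbedding (mulS s) := by
  refine ⟨((continuous_mulS s).isClosedEmbedding (mulS_injective s)).isEmbedding, ?_⟩
  rw [range_mulS]
  have hc : Continuous fun x : SAdicInt s => x.1 1 :=
    (continuous_apply 1).comp continuous_subtype_val
  exact (isOpen_discrete ({0} : Set (ZMod (s ^ 1)))).preimage hc

theorem isClosed_range_mulS (s : ℕ) [NeZero s] : IsClosed (Set.range (mulS s)) :=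
  ((continuous_mulS s).isClosedEmbedding (mulS_injective s)).isClosed_range

/-! ### The endomorphism `𝔞_V` of `C(ℤ_s)` -/

open Classical in
/-- `(𝔞_V f)(x) = f (x / s)` if `s ∣ x`, and `0` otherwise. The quotient `x / s`, i.e. the `y` with
`x = s * y`, is unique since multiplication by `s` is injective on `ℤ_s`. -/
def aVFun (s : ℕ) (f : SAdicInt s → ℂ) (x : SAdicInt s) : ℂ :=
  if h : (s : SAdicInt s) ∣ x then f h.choose else 0

theorem aVFun_mul (s : ℕ) [NeZero s] (f : SAdicInt s → ℂ) (y : SAdicInt s) :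
    aVFun s f ((s : SAdicInt s) * y) = f y := by
  have h : (s : SAdicInt s) ∣ (s : SAdicInt s) * y := dvd_mul_right _ _
  rw [aVFun, dif_pos h]
  congr 1
  exact (mulS_injective s h.choose_spec).symm

theorem aVFun_of_not_dvd (s : ℕ) (f : SAdicInt s → ℂ) (x : SAdicInt s)
    (h : ¬ (s : SAdicInt s) ∣ x) : aVFun s f x = 0 := by
  rw [aVFun, dif_neg h]

theorem continuous_aVFun (s : ℕ) [NeZero s] (f : C(SAdicInt s, ℂ)) : Continuous (aVFun s f) := by
  rw [continuous_iff_continuousAt]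
  intro x
  by_cases hx : (s : SAdicInt s) ∣ x
  · obtain ⟨y, rfl⟩ := hx
    refine ((isOpenEmbedding_mulS s).continuousAt_iff (g := aVFun s f) (x := y)).mp ?_
    have : aVFun s f ∘ mulS s = f := funext fun z => aVFun_mul s f z
    rw [this]
    exact f.continuous.continuousAt
  · have hx' : x ∈ (Set.range (mulS s))ᶜ := by
      rintro ⟨y, rfl⟩
      exact hx ⟨y, rfl⟩
    have he : aVFun s f =ᶠ[nhds x] fun _ => 0 := by
      filter_upwards [(isClosed_range_mulS s).isOpen_compl.mem_nhds hx'] with z hz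
      refine aVFun_of_not_dvd s f z ?_
      rintro ⟨y, rfl⟩
      exact hz ⟨y, rfl⟩
    exact continuousAt_const.congr he.symm

/-- The (non-unital) `*`-endomorphism `𝔞_V` of `C(ℤ_s)`. -/
def aV (s : ℕ) [NeZero s] : C(SAdicInt s, ℂ) →⋆ₙₐ[ℂ] C(SAdicInt s, ℂ) where
  toFun f := ⟨aVFun s f, continuous_aVFun s f⟩
  map_smul' c f := by
    ext x
    change aVFun s (c • f : C(SAdicInt s, ℂ)) x = c • aVFun s f x
    unfold aVFun
    split_ifs <;> simp
  map_zero' := by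
    ext x
    change aVFun s (0 : C(SAdicInt s, ℂ)) x = 0
    unfold aVFun
    split_ifs <;> simp
  map_add' f g := by
    ext x
    change aVFun s (f + g : C(SAdicInt s, ℂ)) x = aVFun s f x + aVFun s g x
    unfold aVFun
    split_ifs <;> simp
  map_mul' f g := by
    ext x
    change aVFun s (f * g : C(SAdicInt s, ℂ)) x = aVFun s f x * aVFun s g x
    unfold aVFun
    split_ifs <;> simp
  map_star' f := by
    ext x
    change aVFun s (star f : C(SAdicInt s, ℂ)) x = star (aVFun s f x)
    unfold aVFun
    split_ifs <;> simp

/-! ### The Hilbert space `ℓ²(𝒱)` and the algebra `A_V` -/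

/-- The set `𝒱` of balls of `ℤ_s`: pairs `(n, x)` with `0 ≤ x < sⁿ`. -/
abbrev Ball (s : ℕ) : Type := Σ n : ℕ, Fin (s ^ n)

/-- The Hilbert space `H = ℓ²(𝒱)`. -/
abbrev H (s : ℕ) : Type := ℓ²(Ball s, ℂ)

/-- The canonical basis vectors of `ℓ²(ι)`. -/
def E {ι : Type} [DecidableEq ι] (i : ι) : ℓ²(ι, ℂ) := lp.single 2 i (1 : ℂ)

theorem orthonormal_E {ι : Type} [DecidableEq ι] : Orthonormal ℂ (E : ι → ℓ²(ι, ℂ)) := by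
  rw [orthonormal_iff_ite]
  intro i j
  unfold E
  rw [lp.inner_single_left, lp.single_apply]
  by_cases hij : i = j
  · subst hij
    simp
  · simp [hij]

/-- The map `(n, x) ↦ (n + 1, s x)` on balls. -/
def shiftBall (s : ℕ) [NeZero s] (b : Ball s) : Ball s :=
  ⟨b.1 + 1, ⟨s * b.2, by
    rw [pow_succ']
    exact Nat.mul_lt_mul_of_pos_left b.2.isLt (Nat.pos_of_ne_zero (NeZero.ne s))⟩⟩

theorem shiftBall_injective (s : ℕ) [NeZero s] : Function.Injective (shiftBall s) := by
  rintro ⟨n, x⟩ ⟨m, y⟩ h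
  have hn : n = m := Nat.succ_injective (congrArg Sigma.fst h)
  subst hn
  have h2 := eq_of_heq (Sigma.mk.inj h).2
  have h3 : s * (x : ℕ) = s * (y : ℕ) := congrArg Fin.val h2
  have h4 : x = y := Fin.ext (Nat.eq_of_mul_eq_mul_left (Nat.pos_of_ne_zero (NeZero.ne s)) h3)
  rw [h4]

/-- The Hensel shift: the isometry `V` of `H` with `V E_(n,x) = E_(n+1, s x)`. -/
def V (s : ℕ) [NeZero s] : H s →L[ℂ] H s :=
  (orthonormal_E.comp (shiftBall s)
    (shiftBall_injective s)).orthogonalFamily.linearIsometry.toContinuousLinearMap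

theorem V_E (s : ℕ) [NeZero s] (b : Ball s) : V s (E b) = E (shiftBall s b) := by
  refine ((orthonormal_E.comp (shiftBall s)
    (shiftBall_injective s)).orthogonalFamily.linearIsometry_apply_single (1 : ℂ)).trans ?_
  simp

/-- The value of `f` at (the center `x` of) the ball `(n, x)`. -/
def centerValue (s : ℕ) (f : C(SAdicInt s, ℂ)) (b : Ball s) : ℂ :=
  f (((b.2 : ℕ) : SAdicInt s))

theorem norm_centerValue_mul_le (s : ℕ) [NeZero s] (f : C(SAdicInt s, ℂ)) (ξ : H s) (b : Ball s) :
    ‖centerValue s f b * ξ b‖ ≤ ‖((‖f‖ : ℂ) • ξ) b‖ := by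
  rw [lp.coeFn_smul, Pi.smul_apply, norm_mul, norm_smul, Complex.norm_real, norm_norm]
  exact mul_le_mul_of_nonneg_right (f.norm_coe_le_norm _) (norm_nonneg _)

/-- The vector `M_f ξ`, i.e. the coordinatewise product of `ξ` with the center values of `f`. -/
def diagVec (s : ℕ) [NeZero s] (f : C(SAdicInt s, ℂ)) (ξ : H s) : H s :=
  ⟨fun b => centerValue s f b * ξ b,
    (lp.memℓp ((‖f‖ : ℂ) • ξ)).mono' (norm_centerValue_mul_le s f ξ)⟩

theorem diagVec_apply (s : ℕ) [NeZero s] (f : C(SAdicInt s, ℂ)) (ξ : H s) (b : Ball s) :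
    diagVec s f ξ b = centerValue s f b * ξ b := rfl

/-- The diagonal operator `M_f` on `H`, with `M_f E_(n,x) = f(x) E_(n,x)`. -/
def M (s : ℕ) [NeZero s] (f : C(SAdicInt s, ℂ)) : H s →L[ℂ] H s :=
  LinearMap.mkContinuous
    { toFun := diagVec s f
      map_add' := fun ξ η => by
        ext b
        simp [diagVec_apply, mul_add]
      map_smul' := fun c ξ => by
        ext b
        simp [diagVec_apply, mul_left_comm] }
    ‖f‖ (fun ξ => by
      have h := lp.norm_mono (p := 2) (by norm_num) (x := diagVec s f ξ) (y := (‖f‖ : ℂ) • ξ)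
        (norm_centerValue_mul_le s f ξ)
      rw [norm_smul, Complex.norm_real, norm_norm] at h
      exact h)

theorem M_apply (s : ℕ) [NeZero s] (f : C(SAdicInt s, ℂ)) (ξ : H s) (b : Ball s) :
    M s f ξ b = f (((b.2 : ℕ) : SAdicInt s)) * ξ b := rfl

theorem M_E (s : ℕ) [NeZero s] (f : C(SAdicInt s, ℂ)) (b : Ball s) :
    M s f (E b) = f (((b.2 : ℕ) : SAdicInt s)) • E b := by
  ext c
  rw [M_apply, lp.coeFn_smul, Pi.smul_apply, smul_eq_mul]
  by_cases h : c = b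
  · rw [h]
  · have h0 : (E b : H s) c = 0 := lp.single_apply_ne _ _ _ h
    rw [h0, mul_zero, mul_zero]

/-- `A_V = C*(V, M_f | f ∈ C(ℤ_s))`, the `C*`-subalgebra of `B(H)` generated by the Hensel shift
and the operators `M_f`. It contains the identity `M_1`. -/
def AV (s : ℕ) [NeZero s] : StarSubalgebra ℂ (H s →L[ℂ] H s) :=
  (StarAlgebra.adjoin ℂ ({V s} ∪ Set.range (M s))).topologicalClosure

instance isClosed_AV (s : ℕ) [NeZero s] : IsClosed (AV s : Set (H s →L[ℂ] H s)) :=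
  StarSubalgebra.isClosed_topologicalClosure _

theorem V_mem_AV (s : ℕ) [NeZero s] : V s ∈ AV s :=
  StarSubalgebra.le_topologicalClosure _
    (StarAlgebra.subset_adjoin ℂ _ (Set.mem_union_left _ rfl))

theorem M_mem_AV (s : ℕ) [NeZero s] (f : C(SAdicInt s, ℂ)) : M s f ∈ AV s :=
  StarSubalgebra.le_topologicalClosure _
    (StarAlgebra.subset_adjoin ℂ _ (Set.mem_union_right _ ⟨f, rfl⟩))

/-- The ball `(0, 0)`, i.e. all of `ℤ_s`. -/
def ball00 (s : ℕ) : Ball s := ⟨0, ⟨0, by rw [pow_zero]; exact Nat.one_pos⟩⟩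

/-- `P_(0,0)`: the orthogonal projection of `H` onto the line spanned by `E_(0,0)`. -/
def P00 (s : ℕ) : H s →L[ℂ] H s := (ℂ ∙ (E (ball00 s) : H s)).starProjection

/-- The operators `V^k P_(0,0) V*^l`. -/
def PTilde (s : ℕ) [NeZero s] (k l : ℕ) : H s →L[ℂ] H s := V s ^ k * P00 s * star (V s) ^ l

/-- `I_V = C*(P_(n,0) | n ≥ 0)`, where `P_(n,0) = V^n P_(0,0) V*^n`. -/
def IV (s : ℕ) [NeZero s] : NonUnitalStarSubalgebra ℂ (H s →L[ℂ] H s) :=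
  (NonUnitalStarAlgebra.adjoin ℂ
    {T | ∃ n : ℕ, T = V s ^ n * P00 s * star (V s) ^ n}).topologicalClosure

/-- `𝓘_V = C*(a V^n | a ∈ I_V, n ≥ 0)`. -/
def IdealV (s : ℕ) [NeZero s] : NonUnitalStarSubalgebra ℂ (H s →L[ℂ] H s) :=
  (NonUnitalStarAlgebra.adjoin ℂ
    {T | ∃ a ∈ IV s, ∃ n : ℕ, T = a * V s ^ n}).topologicalClosure

/-- `C*(V^k P_(0,0) V*^l | k, l ≥ 0)`. -/
def matrixUnitAlgebra (s : ℕ) [NeZero s] : NonUnitalStarSubalgebra ℂ (H s →L[ℂ] H s) :=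
  (NonUnitalStarAlgebra.adjoin ℂ {T | ∃ k l : ℕ, T = PTilde s k l}).topologicalClosure

/-! ### The compact operators -/

/-- The adjoint of a compact operator on a Hilbert space is compact. -/
theorem isCompactOperator_star {X : Type*} [NormedAddCommGroup X] [InnerProductSpace ℂ X]
    [CompleteSpace X] (T : X →L[ℂ] X) (hT : IsCompactOperator T) :
    IsCompactOperator (star T : X →L[ℂ] X) := by
  have hTT : IsCompactOperator (T * star T : X →L[ℂ] X) :=
    hT.comp_clm (star T)
  refine (isCompactOperator_iff_isCompact_closure_image_closedBall
    ((star T : X →L[ℂ] X) : X →ₗ[ℂ] X) one_pos).mpr ?_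
  refine TotallyBounded.isCompact_of_isClosed (TotallyBounded.closure ?_) isClosed_closure
  rw [Metric.totallyBounded_iff]
  intro ε hε
  have hb : TotallyBounded ((T * star T : X →L[ℂ] X) '' Metric.closedBall 0 1) :=
    (hTT.isCompact_closure_image_closedBall (f := ((T * star T : X →L[ℂ] X) : X →ₗ[ℂ] X))
      1).totallyBounded.subset subset_closure
  obtain ⟨t, hts, htf, hcov⟩ := Metric.finite_approx_of_totallyBounded hb (ε ^ 2 / 2) (by positivity)
  choose! r hr using hts
  obtain ⟨u, hu, huf, rfl⟩ : ∃ u ⊆ Metric.closedBall (0 : X) 1, u.Finite ∧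
      (T * star T : X →L[ℂ] X) '' u = t := by
    refine ⟨r '' t, ?_, htf.image r, ?_⟩
    · rintro _ ⟨z, hz, rfl⟩
      exact (hr hz).1
    · rw [Set.image_image]
      exact (Set.image_congr fun z hz => (hr hz).2).trans (Set.image_id' t)
  refine ⟨(star T : X →L[ℂ] X) '' u, huf.image _, ?_⟩
  rintro _ ⟨x, hx, rfl⟩
  have hx2 := hcov ⟨x, hx, rfl⟩
  simp only [Set.mem_iUnion, Set.mem_image, exists_prop, exists_exists_and_eq_and] at hx2 ⊢
  obtain ⟨y, hy, hxy⟩ := hx2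
  refine ⟨y, hy, ?_⟩
  rw [Metric.mem_ball, dist_eq_norm, ← map_sub] at hxy
  rw [Metric.mem_ball, dist_eq_norm]
  change ‖(star T : X →L[ℂ] X) x - (star T : X →L[ℂ] X) y‖ < ε
  rw [← map_sub]
  have hyb := hu hy
  rw [mem_closedBall_zero_iff] at hx hyb
  have hn : ‖x - y‖ ≤ 2 := (norm_sub_le x y).trans (by linarith)
  have hsq : ‖(star T : X →L[ℂ] X) (x - y)‖ ^ 2 < ε ^ 2 := by
    have h1 : ‖(star T : X →L[ℂ] X) (x - y)‖ ^ 2 =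
        RCLike.re (inner ℂ ((T * star T : X →L[ℂ] X) (x - y)) (x - y)) := by
      rw [← inner_self_eq_norm_sq (𝕜 := ℂ)]
      congr 1
      rw [mul_apply_eq_comp, ContinuousLinearMap.star_eq_adjoint,
        ContinuousLinearMap.adjoint_inner_right]
    rw [h1]
    calc _ ≤ ‖(T * star T : X →L[ℂ] X) (x - y)‖ * ‖x - y‖ := re_inner_le_norm _ _
      _ ≤ ‖(T * star T : X →L[ℂ] X) (x - y)‖ * 2 := by gcongr
      _ < ε ^ 2 / 2 * 2 := by gcongr
      _ = ε ^ 2 := by ring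
  exact lt_of_pow_lt_pow_left₀ 2 hε.le hsq

/-- The `C*`-algebra of compact operators on a Hilbert space `X`. -/
def compactOps (X : Type*) [NormedAddCommGroup X] [InnerProductSpace ℂ X] [CompleteSpace X] :
    NonUnitalStarSubalgebra ℂ (X →L[ℂ] X) where
  carrier := {T | IsCompactOperator T}
  add_mem' := fun ha hb => IsCompactOperator.add ha hb
  zero_mem' := isCompactOperator_zero
  mul_mem' := fun {_ b} ha _ => IsCompactOperator.comp_clm ha b
  smul_mem' := fun c _ ha => IsCompactOperator.smul ha c
  star_mem' := fun {a} ha => isCompactOperator_star a ha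

instance isClosed_compactOps (X : Type*) [NormedAddCommGroup X] [InnerProductSpace ℂ X]
    [CompleteSpace X] : IsClosed (compactOps X : Set (X →L[ℂ] X)) :=
  isClosed_setOfPred_isCompactOperator

/-- `𝒦`: the compact operators on the separable infinite-dimensional Hilbert space `ℓ²(ℕ)`. -/
abbrev K : NonUnitalStarSubalgebra ℂ (ℓ²(ℕ, ℂ) →L[ℂ] ℓ²(ℕ, ℂ)) := compactOps ℓ²(ℕ, ℂ)

theorem isCompactOperator_rankOne {X : Type*} [NormedAddCommGroup X] [InnerProductSpace ℂ X]
    (x y : X) : IsCompactOperator (InnerProductSpace.rankOne ℂ x y : X →L[ℂ] X) := by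
  have h : IsCompactOperator (id : ℂ → ℂ) := isCompactOperator_id
  exact (h.comp_clm (innerSL ℂ y)).clm_comp (ContinuousLinearMap.toSpanSingleton ℂ x)

/-- The matrix unit `e_{kl} ∈ 𝒦`, `ξ ↦ ⟪E_l, ξ⟫ E_k`. -/
def matrixUnit (k l : ℕ) : K :=
  ⟨InnerProductSpace.rankOne ℂ (E k : ℓ²(ℕ, ℂ)) (E l : ℓ²(ℕ, ℂ)), isCompactOperator_rankOne _ _⟩

/-! ### The crossed product by an endomorphism -/

universe w u

/-- A covariant pair for an endomorphism `α` of a unital `C*`-algebra `B` in a unital `C*`-algebra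
`D`: a unital `*`-homomorphism `π : B → D` and an isometry `v ∈ D` with `v π(b) v* = π(α(b))`. -/
structure CovariantPair {B : Type w} [CStarAlgebra B] (α : B →⋆ₙₐ[ℂ] B) (D : Type u)
    [CStarAlgebra D] where
  π : B →⋆ₐ[ℂ] D
  v : D
  isometry : star v * v = 1
  covariant : ∀ b : B, v * π b * star v = π (α b)

/-- All covariant pairs for `α`, in nonzero unital `C*`-algebras. -/
structure CovariantRep {B : Type w} [CStarAlgebra B] (α : B →⋆ₙₐ[ℂ] B) : Type (w + 1) where
  D : Type w
  [cstar : CStarAlgebra D]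
  [nontriv : Nontrivial D]
  pair : CovariantPair α D

attribute [instance] CovariantRep.cstar CovariantRep.nontriv

theorem continuous_starAlgHom {A : Type w} {D : Type u} [CStarAlgebra A] [CStarAlgebra D]
    (φ : A →⋆ₐ[ℂ] D) : Continuous φ :=
  AddMonoidHomClass.continuous_of_bound φ 1 fun a => by
    rw [one_mul]
    exact NonUnitalStarAlgHom.norm_apply_le φ a

/-- A `C*`-algebra whose underlying type is small has a `*`-isomorphic copy in the smaller
universe. -/
theorem exists_cstarAlgebra_small (S : Type u) [CStarAlgebra S] [Small.{w} S] :
    ∃ (T : Type w) (_ : CStarAlgebra T), Nonempty (S ≃⋆ₐ[ℂ] T) := by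
  let e : Shrink.{w} S ≃ₐ[ℂ] S := Shrink.algEquiv ℂ S
  let i1 : NormedRing (Shrink.{w} S) := NormedRing.induced (Shrink.{w} S) S e e.injective
  let i2 : StarRing (Shrink.{w} S) :=
    { star := fun x => e.symm (star (e x))
      star_involutive := fun x => by simp
      star_mul := fun x y => by simp
      star_add := fun x y => by simp }
  have hnorm : ∀ x : Shrink.{w} S, ‖x‖ = ‖e x‖ := fun _ => rfl
  have hstar : ∀ x : Shrink.{w} S, e (star x) = star (e x) := fun x => e.apply_symm_apply _
  have hiso : Isometry e := AddMonoidHomClass.isometry_of_norm e fun _ => rfl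
  let i3 : NormedAlgebra ℂ (Shrink.{w} S) :=
    { (inferInstance : Algebra ℂ (Shrink.{w} S)) with
      norm_smul_le := fun c x => by
        rw [hnorm, hnorm, map_smul]
        exact norm_smul_le c (e x) }
  have i4 : CompleteSpace (Shrink.{w} S) :=
    (completeSpace_congr (e := e.toEquiv) hiso.isUniformEmbedding).mpr inferInstance
  have i5 : CStarRing (Shrink.{w} S) :=
    ⟨fun x => by
      rw [hnorm, hnorm, map_mul, hstar]
      exact CStarRing.norm_mul_self_le (e x)⟩
  have i6 : StarModule ℂ (Shrink.{w} S) :=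
    ⟨fun c x => e.injective (by
      rw [hstar, map_smul, map_smul, hstar, star_smul])⟩
  let i7 : CStarAlgebra (Shrink.{w} S) := { i1, i2, i3, i4, i5, i6 with }
  refine ⟨Shrink.{w} S, i7, ⟨StarAlgEquiv.symm (StarAlgEquiv.ofAlgEquiv e hstar)⟩⟩

/-- A `C*`-algebra generated by a small set is small. -/
theorem small_generated {X : Type w} {D : Type u} [CStarAlgebra D] (g : X → D) :
    Small.{w} ((StarAlgebra.adjoin ℂ (Set.range g)).topologicalClosure : StarSubalgebra ℂ D) := by
  let g' : X ⊕ X → D := Sum.elim g (star g)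
  have h1 : ((StarAlgebra.adjoin ℂ (Set.range g) : StarSubalgebra ℂ D) : Set D) =
      Set.range (FreeAlgebra.lift ℂ g') := by
    have : Set.range g' = Set.range g ∪ star (Set.range g) := by
      rw [Set.Sum.elim_range]
      congr 1
      ext x
      simp only [Set.mem_range, Set.mem_star, Pi.star_apply]
      exact exists_congr fun y => ⟨fun h => by rw [← h, star_star], fun h => by rw [h, star_star]⟩
    change ((Algebra.adjoin ℂ (Set.range g ∪ star (Set.range g)) : Subalgebra ℂ D) : Set D) = _
    rw [← this, Algebra.adjoin_range_eq_range_freeAlgebra_lift]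
    rfl
  let A : Set D := Set.range (FreeAlgebra.lift ℂ g')
  let L : (ℕ → FreeAlgebra ℂ (X ⊕ X)) → D := fun a =>
    Filter.limUnder Filter.atTop fun n => FreeAlgebra.lift ℂ g' (a n)
  have h2 : (((StarAlgebra.adjoin ℂ (Set.range g)).topologicalClosure : StarSubalgebra ℂ D) :
      Set D) ⊆ Set.range L := by
    rw [StarSubalgebra.topologicalClosure_coe, h1]
    intro x hx
    obtain ⟨y, hy, hyx⟩ := mem_closure_iff_seq_limit.mp hx
    choose a ha using hy
    refine ⟨a, ?_⟩
    have : (fun n => FreeAlgebra.lift ℂ g' (a n)) = y := funext ha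
    change Filter.limUnder Filter.atTop (fun n => FreeAlgebra.lift ℂ g' (a n)) = x
    rw [this]
    exact hyx.limUnder_eq
  have : Small.{w} (Set.range L) := small_range L
  exact small_subset h2

section CrossedProduct

variable {B : Type w} [CStarAlgebra B] (α : B →⋆ₙₐ[ℂ] B)

/-- The `ℓ^∞`-product of the `C*`-algebras of all covariant pairs. -/
abbrev RepProduct : Type (w + 1) := lp (fun ρ : CovariantRep α => ρ.D) ∞

instance cstarAlgebra_repProduct : CStarAlgebra (RepProduct α) where

/-- The `*`-homomorphism `b ↦ (π_ρ(b))_ρ`. -/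
def prodπ : B →⋆ₐ[ℂ] RepProduct α where
  toFun b := ⟨fun ρ => ρ.pair.π b, memℓp_infty ⟨‖b‖, by
    rintro _ ⟨ρ, rfl⟩
    exact NonUnitalStarAlgHom.norm_apply_le ρ.pair.π b⟩⟩
  map_one' := by
    ext ρ
    exact map_one ρ.pair.π
  map_mul' a b := by
    ext ρ
    exact map_mul ρ.pair.π a b
  map_zero' := by
    ext ρ
    exact map_zero ρ.pair.π
  map_add' a b := by
    ext ρ
    exact map_add ρ.pair.π a b
  commutes' c := by
    ext ρ
    exact AlgHomClass.commutes ρ.pair.π c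
  map_star' b := by
    ext ρ
    exact map_star ρ.pair.π b

theorem norm_isometry_le {D : Type u} [CStarAlgebra D] [Nontrivial D] (v : D)
    (h : star v * v = 1) : ‖v‖ ≤ 1 := by
  have h1 := CStarRing.norm_star_mul_self (x := v)
  rw [h, CStarRing.norm_one] at h1
  nlinarith [norm_nonneg v]

/-- The isometry `(v_ρ)_ρ`. -/
def prodv : RepProduct α :=
  ⟨fun ρ => ρ.pair.v, memℓp_infty ⟨1, by
    rintro _ ⟨ρ, rfl⟩
    exact norm_isometry_le ρ.pair.v ρ.pair.isometry⟩⟩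

/-- Stacey's (multiplicity-one) crossed product `B ⋊_α ℕ`: the universal `C*`-algebra generated by
a copy of `B` and an isometry `v` with `v b v* = α(b)`. It is realized as the `C*`-algebra generated
by the universal pair in the `ℓ^∞`-product over all covariant pairs; its universal property (with
respect to `C*`-algebras in every universe) is `CrossedProduct.existsUnique_lift` below. -/
def crossedProductAlgebra : StarSubalgebra ℂ (RepProduct α) :=
  (StarAlgebra.adjoin ℂ (insert (prodv α) (Set.range (prodπ α)))).topologicalClosure

instance isClosed_crossedProductAlgebra :
    IsClosed (crossedProductAlgebra α : Set (RepProduct α)) :=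
  StarSubalgebra.isClosed_topologicalClosure _

/-- `B ⋊_α ℕ`. -/
abbrev CrossedProduct : Type (w + 1) := crossedProductAlgebra α

theorem subset_crossedProductAlgebra :
    insert (prodv α) (Set.range (prodπ α)) ⊆ (crossedProductAlgebra α : Set (RepProduct α)) :=
  (StarAlgebra.subset_adjoin ℂ _).trans (StarSubalgebra.le_topologicalClosure _)

/-- The canonical covariant pair `(ι, v)` in `B ⋊_α ℕ`. -/
def CrossedProduct.pair : CovariantPair α (CrossedProduct α) where
  π := (prodπ α).codRestrict (crossedProductAlgebra α) fun b =>
    subset_crossedProductAlgebra α (Set.mem_insert_of_mem _ ⟨b, rfl⟩)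
  v := ⟨prodv α, subset_crossedProductAlgebra α (Set.mem_insert _ _)⟩
  isometry := by
    apply Subtype.ext
    ext ρ
    exact ρ.pair.isometry
  covariant b := by
    apply Subtype.ext
    ext ρ
    exact ρ.pair.covariant b

theorem CrossedProduct.existsUnique_lift {D : Type u} [CStarAlgebra D] (p : CovariantPair α D) :
    ∃! φ : CrossedProduct α →⋆ₐ[ℂ] D,
      (∀ b, φ ((CrossedProduct.pair α).π b) = p.π b) ∧ φ (CrossedProduct.pair α).v = p.v := by
  refine existsUnique_of_exists_of_unique ?_ ?_
  · cases subsingleton_or_nontrivial D with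
    | inl h =>
      let φ : CrossedProduct α →⋆ₐ[ℂ] D :=
        { toFun := fun _ => 0
          map_one' := Subsingleton.elim _ _
          map_mul' := fun _ _ => Subsingleton.elim _ _
          map_zero' := Subsingleton.elim _ _
          map_add' := fun _ _ => Subsingleton.elim _ _
          commutes' := fun _ => Subsingleton.elim _ _
          map_star' := fun _ => Subsingleton.elim _ _ }
      exact ⟨φ, fun _ => Subsingleton.elim _ _, Subsingleton.elim _ _⟩
    | inr h =>
      let g : Option B → D := fun o => o.elim p.v p.π
      let S : StarSubalgebra ℂ D := (StarAlgebra.adjoin ℂ (Set.range g)).topologicalClosure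
      have hS : ∀ o, g o ∈ S := fun o => StarSubalgebra.le_topologicalClosure _
        (StarAlgebra.subset_adjoin ℂ _ ⟨o, rfl⟩)
      have : IsClosed (S : Set D) := StarSubalgebra.isClosed_topologicalClosure _
      have : Small.{w} S := small_generated g
      obtain ⟨T, hT, ⟨e⟩⟩ := exists_cstarAlgebra_small.{w} S
      have : Nontrivial T := e.symm.toEquiv.nontrivial
      let q : CovariantPair α T :=
        { π := (e : S →⋆ₐ[ℂ] T).comp (p.π.codRestrict S fun b => hS (some b))
          v := e ⟨p.v, hS none⟩
          isometry := by
            rw [← map_star, ← map_mul, ← map_one e]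
            exact congrArg e (Subtype.ext p.isometry)
          covariant := fun b => by
            change e _ * e _ * star (e _) = e _
            rw [← map_star, ← map_mul, ← map_mul]
            exact congrArg e (Subtype.ext (p.covariant b)) }
      let ρ : CovariantRep α := ⟨T, q⟩
      let ev : CrossedProduct α →⋆ₐ[ℂ] T :=
        { toFun := fun x => x.1 ρ
          map_one' := rfl
          map_mul' := fun _ _ => rfl
          map_zero' := rfl
          map_add' := fun _ _ => rfl
          commutes' := fun _ => rfl
          map_star' := fun _ => rfl }
      refine ⟨S.subtype.comp ((e.symm : T →⋆ₐ[ℂ] S).comp ev), fun b => ?_, ?_⟩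
      · change ((e.symm (e _) : S) : D) = p.π b
        rw [StarAlgEquiv.symm_apply_apply]
        rfl
      · change ((e.symm (e _) : S) : D) = p.v
        rw [StarAlgEquiv.symm_apply_apply]
  · rintro φ ψ ⟨h1, h2⟩ ⟨h3, h4⟩
    refine StarAlgHom.ext_topologicalClosure
      (S := StarAlgebra.adjoin ℂ (insert (prodv α) (Set.range (prodπ α))))
      (continuous_starAlgHom φ) (continuous_starAlgHom ψ) ?_
    refine StarAlgHom.ext_adjoin ?_
    rintro ⟨x, hx⟩ hx'
    rcases hx' with rfl | ⟨b, rfl⟩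
    · exact h2.trans h4.symm
    · exact (h1 b).trans (h3 b).symm

end CrossedProduct

/-! ### The Hensel--Steinitz algebra -/

/-- The Hensel--Steinitz algebra `HS(s) = C(ℤ_s) ⋊_{𝔞_V} ℕ`. -/
abbrev HS (s : ℕ) [NeZero s] : Type 1 := CrossedProduct (aV s)

/-- The canonical copy of `C(ℤ_s)` in `HS(s)`. -/
def HS.ι (s : ℕ) [NeZero s] : C(SAdicInt s, ℂ) →⋆ₐ[ℂ] HS s := (CrossedProduct.pair (aV s)).π

/-- The canonical isometry in `HS(s)`. -/
def HS.v (s : ℕ) [NeZero s] : HS s := (CrossedProduct.pair (aV s)).v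

end HenselShift

end

/-! The pair `M s`, `V s` fails the covariance relation at a single basis vector: the ball (0,0) is
outside the range of the shift, yet its centre 0 is divisible by s. The defect is exactly `P00 s`,
since `M s (aV s 1) - V s * star (V s)` equals it. Giving (n,0) the centre s^n instead of 0 repairs
this: `positiveCenter` is multiplied by s along the shift and is not divisible by s off its range.
So `V s` and the relabelled diagonal operators form a covariant pair and yield `shiftRep`, a
representation of HS(s) on H. The relabelling alters `M s f` only on the orbit of (0,0), where the
diagonal entries change by f(0) - f(s^k), which tends to 0; the change is a compact operator
supported on that orbit.

To make this correction a homomorphism on all of A_V, a second orbit serves as a model: on the balls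
(k+1, s^k), the orbit of (1,1), `V s` is again a unilateral shift and `M s f` has the entries
f(s^k). Elements of A_V commute with both orbit projections, so replacing the restriction to the
zero orbit by a copy of the restriction to this one is a `*`-homomorphism, `retraction`. It fixes `V
s`, sends `M s f` to its relabelled version, and is the identity on the image of `shiftRep`. It
moves each element by a compact operator on the zero orbit (`AV_le_asymptoticAlgebra`,
`sub_retraction_mem`) and kills precisely those compacts (`retraction_eq_zero_iff`), which all lie
in A_V because `P00 s` does.

The remaining point is `shiftRep_injective`, a gauge-invariant uniqueness argument. Averaging over
the circle action that multiplies v by z is faithful on positive elements and maps HS(s) into the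
copy of C(ℤ_s), on which `shiftRep` is injective because the numbers `positiveCenter` are dense in
ℤ_s. The quotient map is then `retraction` followed by the inverse of `shiftRep`. -/

noncomputable section

/-! ### Operators on ℓ² spaces: diagonal operators, basis maps, compactness -/

namespace HenselShift

open InnerProductSpace ContinuousLinearMap Filter

/-! ### Diagonal operators on `ℓ²(ι)` -/

section Diagonal

variable {ι : Type}

/-- Diagonal operators: the canonical representation of `ℓ^∞(ι)` on `ℓ²(ι)`. -/
def diagHom (ι : Type) : lp (fun _ : ι => ℂ) ∞ →⋆ₐ[ℂ] (ℓ²(ι, ℂ) →L[ℂ] ℓ²(ι, ℂ)) :=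
  -- Pointwise domination by a multiple of ξ gives both square summability and the operator bound.
  have key : ∀ (g : lp (fun _ : ι => ℂ) ∞) (ξ : ℓ²(ι, ℂ)) (i : ι),
      ‖g i * ξ i‖ ≤ ‖((‖g‖ : ℂ) • ξ) i‖ := fun g ξ i => by
    rw [lp.coeFn_smul, Pi.smul_apply, norm_mul, norm_smul, Complex.norm_real, norm_norm]
    exact mul_le_mul_of_nonneg_right (lp.norm_apply_le_norm (by norm_num) g i) (norm_nonneg _)
  { toFun := fun g => LinearMap.mkContinuous
      { toFun := fun ξ => (⟨fun i => g i * ξ i, (lp.memℓp ((‖g‖ : ℂ) • ξ)).mono' (key g ξ)⟩ :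
          ℓ²(ι, ℂ))
        map_add' := fun ξ η => by ext i; exact mul_add _ _ _
        map_smul' := fun c ξ => by ext i; exact mul_left_comm _ _ _ }
      ‖g‖ (fun ξ => by
        have h := lp.norm_mono (p := 2) (by norm_num)
          (x := (⟨fun i => g i * ξ i, (lp.memℓp ((‖g‖ : ℂ) • ξ)).mono' (key g ξ)⟩ : ℓ²(ι, ℂ)))
          (y := (‖g‖ : ℂ) • ξ) (key g ξ)
        rw [norm_smul, Complex.norm_real, norm_norm] at h
        exact h)
    map_one' := by ext ξ i; exact one_mul _
    map_mul' := fun a b => by ext ξ i; exact mul_assoc _ _ _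
    map_zero' := by ext ξ i; exact zero_mul _
    map_add' := fun a b => by ext ξ i; exact add_mul _ _ _
    commutes' := fun c => by
      ext ξ i
      change algebraMap ℂ ℂ c * ξ i = ((algebraMap ℂ (ℓ²(ι, ℂ) →L[ℂ] ℓ²(ι, ℂ)) c) ξ) i
      rw [Algebra.algebraMap_eq_smul_one (A := ℓ²(ι, ℂ) →L[ℂ] ℓ²(ι, ℂ))]
      rfl
    map_star' := fun g => by
      rw [star_eq_adjoint, eq_adjoint_iff]
      intro ξ η
      rw [lp.inner_eq_tsum, lp.inner_eq_tsum]
      refine tsum_congr fun i => ?_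
      change inner ℂ (star (g i) * ξ i) (η i) = inner ℂ (ξ i) (g i * η i)
      simp only [RCLike.inner_apply, map_mul, RCLike.star_def, RCLike.conj_conj]
      ring }

theorem diagHom_apply (g : lp (fun _ : ι => ℂ) ∞) (ξ : ℓ²(ι, ℂ)) (i : ι) :
    diagHom ι g ξ i = g i * ξ i := rfl

theorem norm_diagHom_le (g : lp (fun _ : ι => ℂ) ∞) (C : ℝ) (hC : 0 ≤ C) (h : ∀ i, ‖g i‖ ≤ C) :
    ‖diagHom ι g‖ ≤ C :=
  (NonUnitalStarAlgHom.norm_apply_le (diagHom ι) g).trans (lp.norm_le_of_forall_le hC h)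

/-- Pulling back continuous functions on a compact space along a map from a discrete set. -/
def pullback {X : Type*} [TopologicalSpace X] [CompactSpace X] (c : ι → X) :
    C(X, ℂ) →⋆ₐ[ℂ] lp (fun _ : ι => ℂ) ∞ where
  toFun f := ⟨fun i => f (c i), memℓp_infty ⟨‖f‖, by
    rintro _ ⟨i, rfl⟩
    exact f.norm_coe_le_norm _⟩⟩
  map_one' := rfl
  map_mul' _ _ := rfl
  map_zero' := rfl
  map_add' _ _ := rfl
  commutes' _ := rfl
  map_star' _ := rfl

/-- The representation of `C(X)` on `ℓ²(ι)` by evaluation at the points `c i`. -/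
def pointRep {X : Type*} [TopologicalSpace X] [CompactSpace X] (c : ι → X) :
    C(X, ℂ) →⋆ₐ[ℂ] (ℓ²(ι, ℂ) →L[ℂ] ℓ²(ι, ℂ)) := (diagHom ι).comp (pullback c)

end Diagonal

/-! ### Operators on `ℓ²(ι)` given on the canonical basis -/

section Basis

variable {ι κ : Type} [DecidableEq ι] [DecidableEq κ]

theorem E_apply (i k : ι) : (E i : ℓ²(ι, ℂ)) k = if k = i then 1 else 0 := by
  split_ifs with h
  · subst h; exact lp.single_apply_self _ _ _
  · exact lp.single_apply_ne _ _ _ h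

theorem inner_E (i : ι) (ξ : ℓ²(ι, ℂ)) : inner ℂ (E i) ξ = ξ i := by
  rw [E, lp.inner_single_left]
  simp

theorem norm_E (i : ι) : ‖(E i : ℓ²(ι, ℂ))‖ = 1 := orthonormal_E.1 i

theorem hasSum_smul_E (ξ : ℓ²(ι, ℂ)) : HasSum (fun i => ξ i • (E i : ℓ²(ι, ℂ))) ξ := by
  have h := lp.hasSum_single (p := 2) (by norm_num) ξ
  refine h.congr_fun ?_
  intro i
  rw [E, ← lp.single_smul, smul_eq_mul, mul_one]

theorem clm_ext_E {X : Type*} [NormedAddCommGroup X] [NormedSpace ℂ X]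
    {S T : ℓ²(ι, ℂ) →L[ℂ] X} (h : ∀ i, S (E i) = T (E i)) : S = T := by
  ext ξ
  have h1 := (hasSum_smul_E ξ).mapL S
  have h2 := (hasSum_smul_E ξ).mapL T
  simp only [map_smul, h] at h1 h2
  exact h1.unique h2

/-- The isometry `ℓ²(ι) → ℓ²(κ)` with `E_i ↦ E_{j(i)}`, for an injective map `j`. -/
def basisMap (j : ι → κ) (hj : Function.Injective j) : ℓ²(ι, ℂ) →L[ℂ] ℓ²(κ, ℂ) :=
  (orthonormal_E.comp j hj).orthogonalFamily.linearIsometry.toContinuousLinearMap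

theorem basisMap_E (j : ι → κ) (hj : Function.Injective j) (i : ι) :
    basisMap j hj (E i) = E (j i) := by
  refine ((orthonormal_E.comp j hj).orthogonalFamily.linearIsometry_apply_single (1 : ℂ)).trans ?_
  simp

theorem adjoint_basisMap_apply (j : ι → κ) (hj : Function.Injective j) (η : ℓ²(κ, ℂ)) (i : ι) :
    adjoint (basisMap j hj) η i = η (j i) := by
  rw [← inner_E, adjoint_inner_right, basisMap_E, inner_E]

theorem adjoint_basisMap_E (j : ι → κ) (hj : Function.Injective j) (i : ι) :
    adjoint (basisMap j hj) (E (j i)) = E i := by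
  ext k
  rw [adjoint_basisMap_apply, E_apply, E_apply]
  simp [hj.eq_iff]

theorem adjoint_basisMap_E_of_notMem (j : ι → κ) (hj : Function.Injective j) (k : κ)
    (hk : ∀ i, j i ≠ k) : adjoint (basisMap j hj) (E k) = 0 := by
  ext i
  rw [adjoint_basisMap_apply, E_apply, if_neg (hk i)]
  rfl

theorem adjoint_basisMap_comp (j : ι → κ) (hj : Function.Injective j) :
    adjoint (basisMap j hj) ∘L basisMap j hj = 1 :=
  clm_ext_E fun i => by
    rw [ContinuousLinearMap.comp_apply, basisMap_E, adjoint_basisMap_E]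
    rfl

theorem diagHom_E (g : lp (fun _ : ι => ℂ) ∞) (i : ι) : diagHom ι g (E i) = g i • E i := by
  ext k
  rw [diagHom_apply, lp.coeFn_smul, Pi.smul_apply, smul_eq_mul, E_apply]
  split_ifs with h
  · rw [h]
  · simp

theorem pointRep_E {X : Type*} [TopologicalSpace X] [CompactSpace X] (c : ι → X) (f : C(X, ℂ))
    (i : ι) : pointRep c f (E i) = f (c i) • E i := diagHom_E _ i

/-- The diagonal entries recover the values of a function at the points `c i`, and density
determines a continuous function from these. -/
theorem pointRep_injective {X : Type*} [TopologicalSpace X] [CompactSpace X] (c : ι → X)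
    (hc : DenseRange c) : Function.Injective (pointRep c) := by
  intro f g h
  refine ContinuousMap.ext fun x => congrFun (hc.equalizer f.continuous g.continuous ?_) x
  funext i
  have := congrArg (fun T : ℓ²(ι, ℂ) →L[ℂ] ℓ²(ι, ℂ) => T (E i) i) h
  simpa [pointRep_E, E_apply] using this

end Basis

/-! ### Compact operators on `ℓ²(ℕ)` -/

/-- The projection onto the span of `E_0, …, E_{n-1}`. -/
def truncation (n : ℕ) : ℓ²(ℕ, ℂ) →L[ℂ] ℓ²(ℕ, ℂ) :=
  ∑ k ∈ Finset.range n, rankOne ℂ (E k) (E k)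

theorem truncation_apply (n : ℕ) (ξ : ℓ²(ℕ, ℂ)) :
    truncation n ξ = ∑ k ∈ Finset.range n, ξ k • E k := by
  simp [truncation, rankOne_apply, inner_E]

theorem truncation_E (n k : ℕ) : truncation n (E k) = if k < n then E k else 0 := by
  rw [truncation_apply]
  simp [E_apply]

theorem star_truncation (n : ℕ) : star (truncation n) = truncation n := by
  simp [truncation, star_sum, star_eq_adjoint]

theorem norm_one_sub_truncation_le (n : ℕ) : ‖1 - truncation n‖ ≤ 1 := by
  have h : 1 - truncation n = diagHom ℕ ⟨fun k => if k < n then 0 else 1,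
      memℓp_infty ⟨1, by rintro _ ⟨k, rfl⟩; dsimp only; split_ifs <;> simp⟩⟩ := by
    refine clm_ext_E fun k => ?_
    rw [diagHom_E, sub_apply, truncation_E]
    change E k - _ = (if k < n then (0 : ℂ) else 1) • E k
    split_ifs <;> simp
  rw [h]
  refine norm_diagHom_le _ 1 zero_le_one fun k => ?_
  change ‖(if k < n then (0 : ℂ) else 1)‖ ≤ 1
  split_ifs <;> simp

/-- The truncations converge strongly to 1 and `1 - truncation n` is uniformly bounded, so
convergence is uniform on the totally bounded image of the unit ball. -/
theorem tendsto_truncation_mul (T : ℓ²(ℕ, ℂ) →L[ℂ] ℓ²(ℕ, ℂ)) (hT : IsCompactOperator T) :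
    Tendsto (fun n => truncation n * T) atTop (nhds T) := by
  rw [Metric.tendsto_atTop]
  intro ε hε
  have hb : TotallyBounded (T '' Metric.closedBall 0 1) :=
    (hT.isCompact_closure_image_closedBall
      (f := (T : ℓ²(ℕ, ℂ) →ₗ[ℂ] ℓ²(ℕ, ℂ))) 1).totallyBounded.subset subset_closure
  -- A quarter of ε is spent on the distance to the net and a quarter on the net point; the
  -- resulting ε/2 leaves room for the strict inequality.
  obtain ⟨t, htf, hcov⟩ := Metric.totallyBounded_iff.mp hb (ε / 4) (by positivity)
  have hlim : ∀ y : ℓ²(ℕ, ℂ), ∀ᶠ n in atTop, ‖(1 - truncation n) y‖ < ε / 4 := by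
    intro y
    have h := (hasSum_smul_E y).tendsto_sum_nat
    rw [Metric.tendsto_nhds] at h
    filter_upwards [h (ε / 4) (by positivity)] with n hn
    rw [dist_comm, dist_eq_norm, ← truncation_apply] at hn
    exact hn
  obtain ⟨N, hN⟩ := eventually_atTop.mp ((htf.eventually_all).mpr fun y _ => hlim y)
  refine ⟨N, fun n hn => ?_⟩
  rw [dist_comm, dist_eq_norm]
  have hb : ‖T - truncation n * T‖ ≤ ε / 2 := by
    refine opNorm_le_of_unit_norm (by positivity) fun ξ hξ => ?_
    have hmem : T ξ ∈ T '' Metric.closedBall 0 1 := ⟨ξ, by simp [hξ], rfl⟩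
    obtain ⟨y, hy, hyd⟩ := Set.mem_iUnion₂.mp (hcov hmem)
    rw [Metric.mem_ball, dist_eq_norm] at hyd
    have he : (T - truncation n * T) ξ = (1 - truncation n) (T ξ - y) + (1 - truncation n) y := by
      rw [← map_add, sub_add_cancel]
      rfl
    rw [he]
    calc _ ≤ ‖(1 - truncation n) (T ξ - y)‖ + ‖(1 - truncation n) y‖ := norm_add_le _ _
      _ ≤ 1 * ‖T ξ - y‖ + ε / 4 := by
        gcongr
        · exact le_of_opNorm_le _ (norm_one_sub_truncation_le n) _
        · exact (hN n hn y hy).le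
      _ ≤ ε / 2 := by linarith
  linarith

/-- Take adjoints in the left-handed version; the adjoint of a compact operator is compact. -/
theorem tendsto_mul_truncation (T : ℓ²(ℕ, ℂ) →L[ℂ] ℓ²(ℕ, ℂ)) (hT : IsCompactOperator T) :
    Tendsto (fun n => T * truncation n) atTop (nhds T) := by
  have h := (continuous_star.tendsto _).comp
    (tendsto_truncation_mul (star T) (isCompactOperator_star T hT))
  simpa [Function.comp_def, star_mul, star_truncation] using h

theorem truncation_mul_mul_truncation (m n : ℕ) (T : ℓ²(ℕ, ℂ) →L[ℂ] ℓ²(ℕ, ℂ)) :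
    truncation m * (T * truncation n) =
      ∑ k ∈ Finset.range m, ∑ l ∈ Finset.range n, T (E l) k • (matrixUnit k l : _ →L[ℂ] _) := by
  refine clm_ext_E fun i => ?_
  change truncation m (T (truncation n (E i))) = _
  simp only [sum_apply, smul_apply, matrixUnit, rankOne_apply, inner_E, E_apply]
  rw [truncation_E]
  split_ifs with h
  · rw [truncation_apply]
    refine Finset.sum_congr rfl fun k _ => ?_
    simp [h]
  · have : ∀ l ∈ Finset.range n, l ≠ i := fun l hl h' => h (h' ▸ Finset.mem_range.mp hl)
    rw [map_zero, map_zero]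
    symm
    refine Finset.sum_eq_zero fun k _ => Finset.sum_eq_zero fun l hl => ?_
    simp [this l hl]

/-- Every closed subspace containing the matrix units contains all compact operators. -/
theorem compact_mem_of_matrixUnit_mem (S : Submodule ℂ (ℓ²(ℕ, ℂ) →L[ℂ] ℓ²(ℕ, ℂ)))
    (hS : IsClosed (S : Set (ℓ²(ℕ, ℂ) →L[ℂ] ℓ²(ℕ, ℂ))))
    (h : ∀ k l, (matrixUnit k l : ℓ²(ℕ, ℂ) →L[ℂ] ℓ²(ℕ, ℂ)) ∈ S)
    (T : ℓ²(ℕ, ℂ) →L[ℂ] ℓ²(ℕ, ℂ)) (hT : IsCompactOperator T) : T ∈ S := by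
  refine hS.mem_of_tendsto (tendsto_mul_truncation T hT) (Eventually.of_forall fun n => ?_)
  refine hS.mem_of_tendsto (tendsto_truncation_mul (T * truncation n)
    (hT.comp_clm (truncation n))) (Eventually.of_forall fun m => ?_)
  rw [truncation_mul_mul_truncation]
  exact S.sum_mem fun k _ => S.sum_mem fun l _ => S.smul_mem _ (h k l)

/-- A diagonal operator on `ℓ²(ℕ)` whose entries tend to `0` is compact. -/
theorem isCompactOperator_diagHom (g : lp (fun _ : ℕ => ℂ) ∞) (hg : Tendsto g atTop (nhds 0)) :
    IsCompactOperator (diagHom ℕ g) := by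
  have hlim : Tendsto (fun n => truncation n * diagHom ℕ g) atTop (nhds (diagHom ℕ g)) := by
    rw [Metric.tendsto_atTop]
    intro ε hε
    obtain ⟨N, hN⟩ := Metric.tendsto_atTop.mp hg (ε / 2) (by positivity)
    refine ⟨N, fun n hn => ?_⟩
    rw [dist_comm, dist_eq_norm]
    have hb : ∀ k, ‖(if k < n then 0 else g k : ℂ)‖ ≤ ε / 2 := fun k => by
      split_ifs with h
      · rw [norm_zero]; positivity
      · have := hN k (by omega)
        rw [dist_zero_right] at this
        exact this.le
    have he : diagHom ℕ g - truncation n * diagHom ℕ g =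
        diagHom ℕ ⟨fun k => if k < n then 0 else g k, memℓp_infty ⟨ε / 2, by
          rintro _ ⟨k, rfl⟩; exact hb k⟩⟩ := by
      refine clm_ext_E fun k => ?_
      rw [sub_apply, mul_apply_eq_comp, diagHom_E, diagHom_E, map_smul, truncation_E]
      change _ = (if k < n then 0 else g k : ℂ) • E k
      split_ifs <;> simp
    rw [he]
    exact (norm_diagHom_le _ _ (by positivity) hb).trans_lt (by linarith)
  refine isClosed_setOfPred_isCompactOperator.mem_of_tendsto hlim (Eventually.of_forall fun n => ?_)
  have hc : IsCompactOperator (truncation n) :=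
    (compactOps ℓ²(ℕ, ℂ)).sum_mem fun k _ => isCompactOperator_rankOne _ _
  exact hc.comp_clm (diagHom ℕ g)

end HenselShift

end

/-! ### Exchanging two reducing subspaces, and agreement modulo compacts -/

noncomputable section

namespace HenselShift

open InnerProductSpace ContinuousLinearMap Filter

/-! ### Cutting down by partial isometries -/

section Cutting

/-- For a partial isometry `W`, the `*`-homomorphism `T ↦ (1 - W* W) T + W* T W` on the commutant of
the initial and final projections of `W`: it replaces the restriction of `T` to the initial space
by the restriction of `T` to the final space. -/
def replaceHom {A : Type*} [CStarAlgebra A] (W : A) (hW : W * star W * W = W) :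
    StarSubalgebra.centralizer ℂ {star W * W, W * star W} →⋆ₐ[ℂ] A :=
  have hW' : star W * (W * star W) = star W := by
    simpa [mul_assoc] using congrArg star hW
  have comm : ∀ T : StarSubalgebra.centralizer ℂ {star W * W, W * star W},
      star W * W * T.1 = T.1 * (star W * W) ∧ W * star W * T.1 = T.1 * (W * star W) := fun T =>
    ⟨(StarSubalgebra.mem_centralizer_iff ℂ |>.mp T.2 _ (Set.mem_insert _ _)).1,
      (StarSubalgebra.mem_centralizer_iff ℂ |>.mp T.2 _ (Set.mem_insert_of_mem _ rfl)).1⟩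
  { toFun := fun T => (1 - star W * W) * T.1 + star W * T.1 * W
    map_one' := by
      change (1 - star W * W) * 1 + star W * 1 * W = 1
      simp
    map_mul' := fun S T => by
      change (1 - star W * W) * (S.1 * T.1) + star W * (S.1 * T.1) * W =
        ((1 - star W * W) * S.1 + star W * S.1 * W) * ((1 - star W * W) * T.1 + star W * T.1 * W)
      have h1 : (1 - star W * W) * S.1 = S.1 * (1 - star W * W) := by
        rw [sub_mul, mul_sub, one_mul, mul_one, (comm S).1]
      -- `h2` and `h3` kill the cross terms in the product; commutation with the initial projection
      -- and then with the final one handles the two diagonal terms.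
      have h2 : (1 - star W * W) * star W = 0 := by
        rw [sub_mul, one_mul, mul_assoc, hW', sub_self]
      have h3 : W * (1 - star W * W) = 0 := by
        rw [mul_sub, mul_one, ← mul_assoc, hW, sub_self]
      have h4 : (1 - star W * W) * (1 - star W * W) = 1 - star W * W := by
        rw [mul_sub, mul_one, ← mul_assoc, h2, zero_mul, sub_zero]
      have e1 : (1 - star W * W) * S.1 * ((1 - star W * W) * T.1) =
          (1 - star W * W) * (S.1 * T.1) := by
        rw [h1, mul_assoc, ← mul_assoc _ _ T.1, h4, ← mul_assoc, ← h1, mul_assoc]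
      have e2 : (1 - star W * W) * S.1 * (star W * T.1 * W) = 0 := by
        rw [h1, mul_assoc S.1, mul_assoc (star W), ← mul_assoc _ (star W), h2, zero_mul, mul_zero]
      have e3 : star W * S.1 * W * ((1 - star W * W) * T.1) = 0 := by
        rw [mul_assoc, ← mul_assoc W, h3, zero_mul, mul_zero]
      have e4 : star W * S.1 * W * (star W * T.1 * W) = star W * (S.1 * T.1) * W := by
        calc _ = star W * (S.1 * (W * star W)) * T.1 * W := by simp only [mul_assoc]
          _ = star W * (W * star W) * S.1 * T.1 * W := by rw [← (comm S).2]; simp only [mul_assoc]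
          _ = _ := by rw [hW']; simp only [mul_assoc]
      rw [add_mul, mul_add, mul_add, e1, e2, e3, e4, add_zero, zero_add]
    map_zero' := by
      change (1 - star W * W) * 0 + star W * 0 * W = 0
      simp
    map_add' := fun S T => by
      change (1 - star W * W) * (S.1 + T.1) + star W * (S.1 + T.1) * W = _
      simp only [mul_add, add_mul]
      abel
    commutes' := fun c => by
      change (1 - star W * W) * algebraMap ℂ A c + star W * algebraMap ℂ A c * W = _
      rw [mul_assoc (star W), Algebra.commutes c W, ← mul_assoc, ← add_mul, sub_add_cancel, one_mul]
    map_star' := fun T => by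
      change (1 - star W * W) * star T.1 + star W * star T.1 * W = star (_ + _)
      have h := congrArg star (comm T).1
      simp only [star_mul, star_star, mul_assoc] at h
      simp [mul_assoc, sub_mul, h] }

variable {X Y : Type*} [NormedAddCommGroup X] [InnerProductSpace ℂ X] [CompleteSpace X]
  [NormedAddCommGroup Y] [InnerProductSpace ℂ Y] [CompleteSpace Y]

/-- The `*`-homomorphism `T ↦ J T J*` for an isometry `J`. -/
def conjHom (J : X →L[ℂ] Y) (hJ : adjoint J ∘L J = 1) : (X →L[ℂ] X) →⋆ₙₐ[ℂ] (Y →L[ℂ] Y) where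
  toFun T := J ∘L T ∘L adjoint J
  map_smul' c T := by ext y; simp
  map_zero' := by ext y; simp
  map_add' S T := by ext y; simp
  map_mul' S T := by
    ext y
    have h : ∀ x, adjoint J (J x) = x := fun x => congrArg (fun R : X →L[ℂ] X => R x) hJ
    simp [h]
  map_star' T := by
    simp only [star_eq_adjoint, adjoint_comp, adjoint_adjoint]
    rfl

theorem conjHom_apply (J : X →L[ℂ] Y) (hJ : adjoint J ∘L J = 1) (T : X →L[ℂ] X) :
    conjHom J hJ T = J ∘L T ∘L adjoint J := rfl

theorem adjoint_comp_conjHom_comp (J : X →L[ℂ] Y) (hJ : adjoint J ∘L J = 1) (T : X →L[ℂ] X) :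
    adjoint J ∘L conjHom J hJ T ∘L J = T := by
  have h : ∀ x, adjoint J (J x) = x := fun x => congrArg (fun R : X →L[ℂ] X => R x) hJ
  ext x
  simp [h, conjHom_apply]

theorem conjHom_injective (J : X →L[ℂ] Y) (hJ : adjoint J ∘L J = 1) :
    Function.Injective (conjHom J hJ) := fun S T h => by
  rw [← adjoint_comp_conjHom_comp J hJ S, h, adjoint_comp_conjHom_comp]

/-- The compression of operators commuting with the range projection of `J` is multiplicative. -/
theorem compression_mul (J : X →L[ℂ] Y) (hJ : adjoint J ∘L J = 1) (S T : Y →L[ℂ] Y)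
    (hT : (J ∘L adjoint J) * T = T * (J ∘L adjoint J)) :
    adjoint J ∘L (S * T) ∘L J = (adjoint J ∘L S ∘L J) * (adjoint J ∘L T ∘L J) := by
  have h : ∀ x, adjoint J (J x) = x := fun x => congrArg (fun R : X →L[ℂ] X => R x) hJ
  ext x
  have := congrArg (fun R : Y →L[ℂ] Y => R (J x)) hT
  simp only [mul_apply_eq_comp, comp_apply, h] at this
  simp [this]

/-- The operators which commute with the range projections of the isometries `J₀` and `J₁`, and
whose compressions along `J₀` and `J₁` agree up to a compact operator. -/
def asymptoticAlgebra (J₀ J₁ : X →L[ℂ] Y) (h₀ : adjoint J₀ ∘L J₀ = 1) (h₁ : adjoint J₁ ∘L J₁ = 1) :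
    StarSubalgebra ℂ (Y →L[ℂ] Y) where
  carrier := {T | T ∈ StarSubalgebra.centralizer ℂ {J₀ ∘L adjoint J₀, J₁ ∘L adjoint J₁} ∧
    adjoint J₀ ∘L T ∘L J₀ - adjoint J₁ ∘L T ∘L J₁ ∈ compactOps X}
  mul_mem' := by
    rintro S T ⟨hS, hS'⟩ ⟨hT, hT'⟩
    refine ⟨mul_mem hS hT, ?_⟩
    rw [StarSubalgebra.mem_centralizer_iff] at hT
    rw [compression_mul J₀ h₀ S T (hT _ (Set.mem_insert _ _)).1,
      compression_mul J₁ h₁ S T (hT _ (Set.mem_insert_of_mem _ rfl)).1]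
    -- A Leibniz identity: a difference of products lies in the ideal generated by the two
    -- differences.
    have e : ∀ a b c d : X →L[ℂ] X, a * c - b * d = (a - b) * c + b * (c - d) := fun a b c d => by
      noncomm_ring
    rw [e]
    have k1 : (adjoint J₀ ∘L S ∘L J₀ - adjoint J₁ ∘L S ∘L J₁) * (adjoint J₀ ∘L T ∘L J₀) ∈
        compactOps X := IsCompactOperator.comp_clm hS' _
    have k2 : (adjoint J₁ ∘L S ∘L J₁) * (adjoint J₀ ∘L T ∘L J₀ - adjoint J₁ ∘L T ∘L J₁) ∈
        compactOps X := IsCompactOperator.clm_comp hT' (adjoint J₁ ∘L S ∘L J₁)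
    exact add_mem k1 k2
  add_mem' := by
    rintro S T ⟨hS, hS'⟩ ⟨hT, hT'⟩
    refine ⟨add_mem hS hT, ?_⟩
    have e := add_mem hS' hT'
    rw [sub_add_sub_comm] at e
    simpa only [add_comp, comp_add] using e
  algebraMap_mem' c := by
    refine ⟨algebraMap_mem _ c, ?_⟩
    have e : ∀ J : X →L[ℂ] Y, adjoint J ∘L J = 1 →
        adjoint J ∘L (algebraMap ℂ (Y →L[ℂ] Y) c) ∘L J = c • 1 := fun J hJ => by
      rw [← hJ, Algebra.algebraMap_eq_smul_one]
      ext x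
      simp
    rw [e J₀ h₀, e J₁ h₁, sub_self]
    exact zero_mem _
  star_mem' := by
    rintro T ⟨hT, hT'⟩
    refine ⟨star_mem hT, ?_⟩
    have e := star_mem hT'
    rw [star_sub] at e
    simpa only [star_eq_adjoint, adjoint_comp, adjoint_adjoint, comp_assoc] using e

/-- Closedness lets membership be checked on the generators of A_V only. -/
theorem isClosed_asymptoticAlgebra (J₀ J₁ : X →L[ℂ] Y) (h₀ : adjoint J₀ ∘L J₀ = 1)
    (h₁ : adjoint J₁ ∘L J₁ = 1) :
    IsClosed (asymptoticAlgebra J₀ J₁ h₀ h₁ : Set (Y →L[ℂ] Y)) := by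
  refine IsClosed.inter ?_ ?_
  · change IsClosed (StarSubalgebra.centralizer ℂ {J₀ ∘L adjoint J₀, J₁ ∘L adjoint J₁} :
      Set (Y →L[ℂ] Y))
    rw [StarSubalgebra.coe_centralizer]
    exact Set.isClosed_centralizer _
  · refine (isClosed_compactOps X).preimage ?_
    fun_prop

/-- With W = J₁J₀*, W*W is the range projection of J₀ and W*TW = J₀(J₁*TJ₁)J₀*; as T commutes with
that projection, only the difference of the two compressions survives, carried by J₀. -/
theorem sub_replace_eq_conjHom (J₀ J₁ : X →L[ℂ] Y) (h₀ : adjoint J₀ ∘L J₀ = 1)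
    (h₁ : adjoint J₁ ∘L J₁ = 1) (W : Y →L[ℂ] Y) (hW : W = J₁ ∘L adjoint J₀) (T : Y →L[ℂ] Y)
    (hT : (J₀ ∘L adjoint J₀) * T = T * (J₀ ∘L adjoint J₀)) :
    T - ((1 - star W * W) * T + star W * T * W) =
      conjHom J₀ h₀ (adjoint J₀ ∘L T ∘L J₀ - adjoint J₁ ∘L T ∘L J₁) := by
  have h0 : ∀ x, adjoint J₀ (J₀ x) = x := fun x => congrArg (fun R : X →L[ℂ] X => R x) h₀
  have h1 : ∀ x, adjoint J₁ (J₁ x) = x := fun x => congrArg (fun R : X →L[ℂ] X => R x) h₁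
  ext y
  have h2 := congrArg (fun R : Y →L[ℂ] Y => J₀ (adjoint J₀ (R y))) hT
  simp only [mul_apply_eq_comp, comp_apply, h0] at h2
  subst hW
  simp [conjHom_apply, star_eq_adjoint, adjoint_comp, h1, sub_mul, ← h2]
  abel

end Cutting

end HenselShift

end

/-! ### Arithmetic of ball centres and the covariant pair on H -/

noncomputable section

namespace HenselShift

open InnerProductSpace ContinuousLinearMap Filter

/-! ### Integers in `ℤ_s` -/

section Integers

variable (s : ℕ)

theorem natCast_apply (m n : ℕ) : ((m : SAdicInt s) : ∀ n : ℕ, ZMod (s ^ n)) n = m := rfl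

theorem dvd_of_natCast_dvd (m : ℕ) (h : (s : SAdicInt s) ∣ (m : SAdicInt s)) : s ∣ m := by
  obtain ⟨y, hy⟩ := h
  have h1 : (m : ZMod (s ^ 1)) = (s : ZMod (s ^ 1)) * y.1 1 :=
    congrArg (fun z : SAdicInt s => z.1 1) hy
  have h2 : ((s : ℕ) : ZMod (s ^ 1)) = 0 := by
    rw [ZMod.natCast_eq_zero_iff, pow_one]
  rwa [h2, zero_mul, ZMod.natCast_eq_zero_iff, pow_one] at h1

theorem natCast_val [NeZero s] (x : SAdicInt s) {m n : ℕ} (hmn : m ≤ n) :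
    (((x.1 n).val : ℕ) : ZMod (s ^ m)) = x.1 m := by
  induction n, hmn using Nat.le_induction with
  | base => rw [ZMod.natCast_zmod_val]
  | succ n hmn ih =>
    rw [← ih, ← val_succ_mod s x n, ZMod.natCast_eq_natCast_iff]
    exact ((Nat.mod_modEq _ _).of_dvd (pow_dvd_pow s hmn)).symm

/-- The summand s^n tends to 0 in ℤ_s, so it does not affect the limit; it makes every approximant
nonzero, hence realizable as a `positiveCenter`. -/
theorem tendsto_natCast_val_add [NeZero s] (x : SAdicInt s) :
    Tendsto (fun n => (((x.1 n).val + s ^ n : ℕ) : SAdicInt s)) atTop (nhds x) := by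
  rw [tendsto_subtype_rng, tendsto_pi_nhds]
  intro m
  refine tendsto_const_nhds.congr' ?_
  filter_upwards [eventually_ge_atTop m] with n hn
  rw [natCast_apply, Nat.cast_add, natCast_val s x hn,
    (ZMod.natCast_eq_zero_iff (s ^ n) (s ^ m)).mpr (pow_dvd_pow s hn), add_zero]

theorem tendsto_pow [NeZero s] :
    Tendsto (fun n => ((s ^ n : ℕ) : SAdicInt s)) atTop (nhds 0) := by
  refine (tendsto_natCast_val_add s 0).congr fun n => ?_
  have : ((0 : SAdicInt s).1 n).val = 0 := ZMod.val_zero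
  rw [this, zero_add]

end Integers

/-! ### The two orbits and the modified centers -/

section Orbits

variable (s : ℕ)

theorem ball_ext {b c : Ball s} (h : b.1 = c.1) (h' : (b.2 : ℕ) = c.2) : b = c := by
  obtain ⟨n, x⟩ := b
  obtain ⟨m, y⟩ := c
  obtain rfl : n = m := h
  obtain rfl : x = y := Fin.ext h'
  rfl

/-- The orbit `(k + 1, s ^ k)` of `(1, 1)` under the shift. -/
def oneBall (hs : 2 ≤ s) (k : ℕ) : Ball s := ⟨k + 1, ⟨s ^ k, Nat.pow_lt_pow_right hs k.lt_succ_self⟩⟩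

theorem oneBall_injective (hs : 2 ≤ s) : Function.Injective (oneBall s hs) := fun _ _ h =>
  Nat.succ_injective (congrArg Sigma.fst h)

/-- The natural number `x` for a ball `(n, x)` with `x ≠ 0`, and `s ^ n` for `(n, 0)`. -/
def positiveCenter (b : Ball s) : ℕ := if (b.2 : ℕ) = 0 then s ^ b.1 else b.2

theorem positiveCenter_of_ne {b : Ball s} (h : (b.2 : ℕ) ≠ 0) : positiveCenter s b = b.2 := if_neg h

variable [NeZero s]

/-- The orbit `(k, 0)` of `(0, 0)` under the shift. -/
def zeroBall (k : ℕ) : Ball s := ⟨k, ⟨0, Nat.pow_pos (Nat.pos_of_ne_zero (NeZero.ne s))⟩⟩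

theorem zeroBall_injective : Function.Injective (zeroBall s) := fun _ _ h => congrArg Sigma.fst h

theorem shiftBall_zeroBall (k : ℕ) : shiftBall s (zeroBall s k) = zeroBall s (k + 1) :=
  ball_ext s rfl (mul_zero s)

theorem shiftBall_oneBall (hs : 2 ≤ s) (k : ℕ) :
    shiftBall s (oneBall s hs k) = oneBall s hs (k + 1) :=
  ball_ext s rfl (pow_succ' s k).symm

theorem shiftBall_ne_zeroBall (b : Ball s) : shiftBall s b ≠ zeroBall s 0 := fun h =>
  Nat.succ_ne_zero _ (congrArg Sigma.fst h)

/-- Since s ≥ 2 does not divide 1, this orbit too starts outside the range of the shift, which makes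
`V s` restrict to a unilateral shift on it. -/
theorem shiftBall_ne_oneBall (hs : 2 ≤ s) (b : Ball s) : shiftBall s b ≠ oneBall s hs 0 := fun h => by
  have h1 : s * (b.2 : ℕ) = s ^ 0 := congrArg (fun c : Ball s => (c.2 : ℕ)) h
  have h2 := Nat.eq_one_of_mul_eq_one_right h1
  omega

theorem oneBall_ne_zeroBall (hs : 2 ≤ s) (k l : ℕ) : oneBall s hs k ≠ zeroBall s l := fun h => by
  have h1 : s ^ k = 0 := congrArg (fun c : Ball s => (c.2 : ℕ)) h
  exact (Nat.pow_pos (Nat.pos_of_ne_zero (NeZero.ne s))).ne' h1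

theorem eq_zeroBall_or_ne (b : Ball s) : (∃ k, b = zeroBall s k) ∨ (b.2 : ℕ) ≠ 0 := by
  by_cases h : (b.2 : ℕ) = 0
  · exact Or.inl ⟨b.1, ball_ext s rfl h⟩
  · exact Or.inr h

theorem positiveCenter_zeroBall (k : ℕ) : positiveCenter s (zeroBall s k) = s ^ k := if_pos rfl

/-- This equivariance is why (n,0) is relabelled by s^n. -/
theorem positiveCenter_shiftBall (b : Ball s) :
    positiveCenter s (shiftBall s b) = s * positiveCenter s b := by
  obtain ⟨k, rfl⟩ | h := eq_zeroBall_or_ne s b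
  · rw [shiftBall_zeroBall, positiveCenter_zeroBall, positiveCenter_zeroBall, pow_succ']
  · rw [positiveCenter_of_ne s h, positiveCenter_of_ne]
    · rfl
    · exact mul_ne_zero (NeZero.ne s) h

/-- The original centres violate this only at (0,0), now labelled 1. A nonzero centre x = sy of
level n+1 has y < s^n, so its ball is a shift. -/
theorem not_dvd_positiveCenter (hs : 2 ≤ s) (b : Ball s) (hb : ∀ c, shiftBall s c ≠ b) :
    ¬ (s : SAdicInt s) ∣ (positiveCenter s b : SAdicInt s) := by
  intro h
  replace h := dvd_of_natCast_dvd s _ h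
  obtain ⟨k, rfl⟩ | h' := eq_zeroBall_or_ne s b
  · cases k with
    | zero =>
      rw [positiveCenter_zeroBall, pow_zero, Nat.dvd_one] at h
      omega
    | succ k => exact hb _ (shiftBall_zeroBall s k)
  · rw [positiveCenter_of_ne s h'] at h
    obtain ⟨n, x⟩ := b
    obtain ⟨y, hy⟩ := h
    have hxy : (x : ℕ) = s * y := hy
    cases n with
    | zero =>
      exact h' (Nat.lt_one_iff.mp (x.2.trans_eq (pow_zero s)))
    | succ n =>
      have hx : (x : ℕ) < s ^ (n + 1) := x.2
      rw [hxy, pow_succ'] at hx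
      exact hb ⟨n, ⟨y, Nat.lt_of_mul_lt_mul_left hx⟩⟩ (ball_ext s rfl hxy.symm)

theorem denseRange_positiveCenter (hs : 2 ≤ s) :
    DenseRange fun b : Ball s => (positiveCenter s b : SAdicInt s) := by
  intro x
  refine mem_closure_of_tendsto (tendsto_natCast_val_add s x) (Eventually.of_forall fun n => ?_)
  -- The sum is below 2s^n ≤ s^(n+1), so it is the centre of a ball one level deeper; this uses s ≥
  -- 2.
  have hlt : (x.1 n).val + s ^ n < s ^ (n + 1) := by
    have h1 : (x.1 n).val < s ^ n := ZMod.val_lt _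
    have h2 : s ^ n * 2 ≤ s ^ (n + 1) := by
      rw [pow_succ]; exact Nat.mul_le_mul_left _ hs
    omega
  refine ⟨⟨n + 1, ⟨_, hlt⟩⟩, ?_⟩
  have hne : (x.1 n).val + s ^ n ≠ 0 :=
    (Nat.add_pos_right _ (Nat.pow_pos (Nat.pos_of_ne_zero (NeZero.ne s)))).ne'
  exact congrArg Nat.cast (positiveCenter_of_ne s (b := ⟨n + 1, ⟨_, hlt⟩⟩) hne)

end Orbits

/-! ### The representation of `HS(s)` on `ℓ²(𝒱)` -/

section Representation

variable (s : ℕ) [NeZero s]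

theorem star_V_E_shiftBall (b : Ball s) : star (V s) (E (shiftBall s b)) = E b :=
  adjoint_basisMap_E _ (shiftBall_injective s) b

theorem star_V_E_of_ne (b : Ball s) (hb : ∀ c, shiftBall s c ≠ b) : star (V s) (E b) = 0 :=
  adjoint_basisMap_E_of_notMem _ (shiftBall_injective s) b hb

theorem star_V_mul_V : star (V s) * V s = 1 := adjoint_basisMap_comp _ (shiftBall_injective s)

theorem M_eq_pointRep (f : C(SAdicInt s, ℂ)) :
    M s f = pointRep (fun b : Ball s => ((b.2 : ℕ) : SAdicInt s)) f :=
  clm_ext_E fun b => by rw [M_E, pointRep_E]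

/-- The covariant pair of the Hensel shift and the diagonal operators `E_(n,x) ↦ f(x) E_(n,x)` for
`x ≠ 0`, `E_(n,0) ↦ f(s ^ n) E_(n,0)`. -/
def shiftPair (hs : 2 ≤ s) : CovariantPair (aV s) (H s →L[ℂ] H s) where
  π := pointRep fun b : Ball s => (positiveCenter s b : SAdicInt s)
  v := V s
  isometry := star_V_mul_V s
  covariant f := clm_ext_E fun b => by
    rw [mul_apply_eq_comp, mul_apply_eq_comp, pointRep_E]
    change _ = aVFun s f _ • _
    -- On the range of the shift both sides are f at the previous centre; off it, V* kills the
    -- vector and non-divisibility kills the right side.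
    by_cases hb : ∃ c, shiftBall s c = b
    · obtain ⟨c, rfl⟩ := hb
      rw [star_V_E_shiftBall, pointRep_E, map_smul, V_E, positiveCenter_shiftBall, Nat.cast_mul,
        aVFun_mul]
    · push Not at hb
      rw [star_V_E_of_ne s b hb, map_zero, map_zero,
        aVFun_of_not_dvd s f _ (not_dvd_positiveCenter s hs b hb), zero_smul]

/-- The representation of `HS(s)` on `ℓ²(𝒱)` given by `shiftPair`. -/
def shiftRep (hs : 2 ≤ s) : HS s →⋆ₐ[ℂ] (H s →L[ℂ] H s) :=
  (CrossedProduct.existsUnique_lift (aV s) (shiftPair s hs)).choose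

theorem shiftRep_ι (hs : 2 ≤ s) (f : C(SAdicInt s, ℂ)) : shiftRep s hs (HS.ι s f) =
    pointRep (fun b : Ball s => (positiveCenter s b : SAdicInt s)) f :=
  (CrossedProduct.existsUnique_lift (aV s) (shiftPair s hs)).choose_spec.1.1 f

theorem shiftRep_v (hs : 2 ≤ s) : shiftRep s hs (HS.v s) = V s :=
  (CrossedProduct.existsUnique_lift (aV s) (shiftPair s hs)).choose_spec.1.2

end Representation

end HenselShift

end

/-! ### Tools for faithfulness: positive integrals and words in HS(s) -/

noncomputable section

namespace HenselShift

open ContinuousLinearMap Filter MeasureTheory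

/-! ### Positive functions with vanishing integral -/

section Positive

attribute [local instance] CStarAlgebra.spectralOrder CStarAlgebra.spectralOrderedRing

/-- The primitive starting at `a` is nonnegative and bounded by its value 0 at `b`, so it vanishes
on the interval, and `f c` is its derivative at an interior point. -/
theorem eq_zero_of_integral_eq_zero {A : Type*} [CStarAlgebra A] (f : ℝ → A) (hf : Continuous f)
    {a b c : ℝ} (hac : a < c) (hcb : c < b) (hpos : ∀ t, ∃ y, f t = star y * y)
    (h0 : ∫ t in a..b, f t = 0) : f c = 0 := by
  have hnn : ∀ t, 0 ≤ f t := fun t => by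
    obtain ⟨y, hy⟩ := hpos t
    rw [hy]
    exact star_mul_self_nonneg y
  have hint : ∀ x y : ℝ, x ≤ y → 0 ≤ ∫ t in x..y, f t := fun x y hxy => by
    rw [intervalIntegral.integral_of_le hxy]
    exact integral_nonneg fun t => hnn t
  have hF : ∀ t ∈ Set.Icc a b, ∫ u in a..t, f u = 0 := fun t ht => by
    have h1 := hint t b ht.2
    have h2 := intervalIntegral.integral_add_adjacent_intervals
      (hf.intervalIntegrable (μ := volume) a t) (hf.intervalIntegrable t b)
    rw [h0] at h2
    rw [eq_neg_of_add_eq_zero_right h2] at h1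
    exact le_antisymm (neg_nonneg.mp h1) (hint a t ht.1)
  have hd : HasDerivAt (fun t => ∫ u in a..t, f u) (f c) c :=
    intervalIntegral.integral_hasDerivAt_right (hf.intervalIntegrable a c)
      (hf.stronglyMeasurableAtFilter _ _) hf.continuousAt
  have hz : (fun t => ∫ u in a..t, f u) =ᶠ[nhds c] fun _ => 0 := by
    filter_upwards [Icc_mem_nhds hac hcb] with t ht using hF t ht
  exact hd.unique ((hasDerivAt_const c (0 : A)).congr_of_eventuallyEq hz)

end Positive

/-! ### Words in a covariant pair -/

section Words

universe u w

variable {B : Type w} [CStarAlgebra B] {α : B →⋆ₙₐ[ℂ] B} {D : Type u} [CStarAlgebra D]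

theorem CovariantPair.v_mul_π (p : CovariantPair α D) (b : B) : p.v * p.π b = p.π (α b) * p.v := by
  rw [← p.covariant, mul_assoc, p.isometry, mul_one]

theorem CovariantPair.π_mul_star_v (p : CovariantPair α D) (b : B) :
    p.π b * star p.v = star p.v * p.π (α b) := by
  rw [← p.covariant, ← mul_assoc, ← mul_assoc, p.isometry, one_mul]

theorem CovariantPair.v_mul_star_v (p : CovariantPair α D) : p.v * star p.v = p.π (α 1) := by
  rw [← p.covariant, map_one, mul_one]

theorem CovariantPair.π_mul_star_v_pow (p : CovariantPair α D) (n : ℕ) (b : B) :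
    p.π b * star p.v ^ n = star p.v ^ n * p.π (α^[n] b) := by
  induction n generalizing b with
  | zero => simp
  | succ n ih =>
    rw [pow_succ', ← mul_assoc, p.π_mul_star_v, mul_assoc, ih, ← mul_assoc,
      Function.iterate_succ_apply]

/-- The image of a covariant pair under a `*`-homomorphism. -/
def CovariantPair.map {D' : Type*} [CStarAlgebra D'] (p : CovariantPair α D) (φ : D →⋆ₐ[ℂ] D') :
    CovariantPair α D' where
  π := φ.comp p.π
  v := φ p.v
  isometry := by rw [← map_star, ← map_mul, p.isometry, map_one]
  covariant b := by
    change φ _ * φ _ * _ = φ _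
    rw [← map_star, ← map_mul, ← map_mul]
    exact congrArg φ (p.covariant b)

/-- Both homomorphisms lift the same covariant pair, namely the image of the canonical one under ψ.
-/
theorem CrossedProduct.hom_ext {φ ψ : CrossedProduct α →⋆ₐ[ℂ] D}
    (h : ∀ b, φ ((CrossedProduct.pair α).π b) = ψ ((CrossedProduct.pair α).π b))
    (hv : φ (CrossedProduct.pair α).v = ψ (CrossedProduct.pair α).v) : φ = ψ :=
  (CrossedProduct.existsUnique_lift α ((CrossedProduct.pair α).map ψ)).unique ⟨h, hv⟩
    ⟨fun _ => rfl, rfl⟩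

/-- A closed `*`-subalgebra containing the canonical generators is the whole crossed product. -/
theorem CrossedProduct.eq_top_of_isClosed (S : StarSubalgebra ℂ (CrossedProduct α))
    (hS : IsClosed (S : Set (CrossedProduct α)))
    (hπ : ∀ b, (CrossedProduct.pair α).π b ∈ S) (hv : (CrossedProduct.pair α).v ∈ S) : S = ⊤ := by
  let p : CovariantPair α S :=
    { π := (CrossedProduct.pair α).π.codRestrict S hπ
      v := ⟨_, hv⟩
      isometry := Subtype.ext (CrossedProduct.pair α).isometry
      covariant := fun b => Subtype.ext ((CrossedProduct.pair α).covariant b) }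
  obtain ⟨φ, ⟨h1, h2⟩, -⟩ := CrossedProduct.existsUnique_lift α p
  have h : S.subtype.comp φ = StarAlgHom.id ℂ _ :=
    CrossedProduct.hom_ext (fun b => congrArg Subtype.val (h1 b)) (congrArg Subtype.val h2)
  refine eq_top_iff.mpr fun x _ => ?_
  have hx : ((φ x : S) : CrossedProduct α) = x := congrArg (fun f => f x) h
  exact hx ▸ (φ x).2

end Words

/-! ### The normal form in `HS(s)` -/

section NormalForm

variable (s : ℕ) [NeZero s]

/-- Composition with multiplication by s is a left inverse of `aV s`; compressing the covariance
relation for f(s·) by v turns it into this transfer formula. -/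
theorem star_v_mul_ι_mul_v (f : C(SAdicInt s, ℂ)) : star (HS.v s) * HS.ι s f * HS.v s =
    HS.ι s (f.comp ⟨mulS s, continuous_mulS s⟩) := by
  have key : aV s (f.comp ⟨mulS s, continuous_mulS s⟩) = aV s 1 * f := by
    ext x
    change aVFun s _ x = aVFun s _ x * f x
    by_cases hx : (s : SAdicInt s) ∣ x
    · obtain ⟨y, rfl⟩ := hx
      rw [aVFun_mul, aVFun_mul]
      exact (one_mul _).symm
    · rw [aVFun_of_not_dvd s _ x hx, aVFun_of_not_dvd s _ x hx, zero_mul]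
  have h1 := (CrossedProduct.pair (aV s)).v_mul_star_v
  have h2 := (CrossedProduct.pair (aV s)).covariant (f.comp ⟨mulS s, continuous_mulS s⟩)
  have h3 := (CrossedProduct.pair (aV s)).isometry
  rw [key, map_mul, ← h1] at h2
  replace h2 := congrArg (fun x => star (HS.v s) * x * HS.v s) h2
  simp only [← mul_assoc] at h2
  change star (HS.v s) * HS.v s * HS.ι s _ * star (HS.v s) * HS.v s =
    star (HS.v s) * HS.v s * star (HS.v s) * HS.ι s f * HS.v s at h2
  change star (HS.v s) * HS.v s = 1 at h3
  rw [mul_assoc _ (star (HS.v s)) (HS.v s), h3, one_mul, mul_one, one_mul] at h2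
  exact h2.symm

/-- The span of the words `f v^n` and `v*^n f`. -/
def wordSpan : Submodule ℂ (HS s) :=
  Submodule.span ℂ {y | ∃ (n : ℕ) (f : C(SAdicInt s, ℂ)),
    y = HS.ι s f * HS.v s ^ n ∨ y = star (HS.v s) ^ n * HS.ι s f}

variable {s}

theorem word_mem (n : ℕ) (f : C(SAdicInt s, ℂ)) : HS.ι s f * HS.v s ^ n ∈ wordSpan s :=
  Submodule.subset_span ⟨n, f, Or.inl rfl⟩

theorem star_word_mem (n : ℕ) (f : C(SAdicInt s, ℂ)) : star (HS.v s) ^ n * HS.ι s f ∈ wordSpan s :=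
  Submodule.subset_span ⟨n, f, Or.inr rfl⟩

theorem mul_mem_wordSpan_of_forall (x : HS s)
    (h1 : ∀ n f, x * (HS.ι s f * HS.v s ^ n) ∈ wordSpan s)
    (h2 : ∀ n f, x * (star (HS.v s) ^ n * HS.ι s f) ∈ wordSpan s) {y : HS s} (hy : y ∈ wordSpan s) :
    x * y ∈ wordSpan s := by
  induction hy using Submodule.span_induction with
  | mem y hy =>
    obtain ⟨n, f, rfl | rfl⟩ := hy
    · exact h1 n f
    · exact h2 n f
  | zero => rw [mul_zero]; exact zero_mem _
  | add y z _ _ hy hz => rw [mul_add]; exact add_mem hy hz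
  | smul c y _ hy => rw [mul_smul_comm]; exact Submodule.smul_mem _ c hy

/-- Functions move to the right across v*^n at the cost of applying `aV s` n times. -/
theorem ι_mul_mem_wordSpan (g : C(SAdicInt s, ℂ)) {y : HS s} (hy : y ∈ wordSpan s) :
    HS.ι s g * y ∈ wordSpan s := by
  refine mul_mem_wordSpan_of_forall _ (fun n f => ?_) (fun n f => ?_) hy
  · rw [← mul_assoc, ← map_mul]
    exact word_mem n _
  · have h := (CrossedProduct.pair (aV s)).π_mul_star_v_pow n g
    change HS.ι s g * star (HS.v s) ^ n = star (HS.v s) ^ n * HS.ι s _ at h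
    rw [← mul_assoc, h, mul_assoc, ← map_mul]
    exact star_word_mem n _

/-- In front of v*^(n+1) the product v v* is a function, so the word shortens. -/
theorem v_mul_mem_wordSpan {y : HS s} (hy : y ∈ wordSpan s) : HS.v s * y ∈ wordSpan s := by
  have h : ∀ f, HS.v s * HS.ι s f = HS.ι s (aV s f) * HS.v s :=
    (CrossedProduct.pair (aV s)).v_mul_π
  refine mul_mem_wordSpan_of_forall _ (fun n f => ?_) (fun n f => ?_) hy
  · rw [← mul_assoc, h, mul_assoc, ← pow_succ']
    exact word_mem _ _
  · cases n with
    | zero =>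
      rw [pow_zero, one_mul, h]
      simpa using word_mem 1 (aV s f)
    | succ n =>
      have h' : HS.v s * star (HS.v s) = HS.ι s (aV s 1) :=
        (CrossedProduct.pair (aV s)).v_mul_star_v
      rw [pow_succ', mul_assoc, ← mul_assoc (HS.v s), h']
      exact ι_mul_mem_wordSpan _ (star_word_mem n f)

theorem star_v_mul_mem_wordSpan {y : HS s} (hy : y ∈ wordSpan s) :
    star (HS.v s) * y ∈ wordSpan s := by
  refine mul_mem_wordSpan_of_forall _ (fun n f => ?_) (fun n f => ?_) hy
  · cases n with
    | zero =>
      rw [pow_zero, mul_one]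
      simpa using star_word_mem 1 f
    | succ n =>
      rw [pow_succ', ← mul_assoc, ← mul_assoc, star_v_mul_ι_mul_v]
      exact word_mem n _
  · rw [← mul_assoc, ← pow_succ']
    exact star_word_mem _ _

/-- The span contains 1 and is stable under left multiplication by each generator and its adjoint.
Carrying `x` and `star x` together makes the star case of the induction immediate. -/
theorem adjoin_le_wordSpan {y : HS s}
    (hy : y ∈ StarAlgebra.adjoin ℂ (insert (HS.v s) (Set.range (HS.ι s)))) : y ∈ wordSpan s := by
  have h : ∀ x ∈ StarAlgebra.adjoin ℂ (insert (HS.v s) (Set.range (HS.ι s))),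
      (∀ y ∈ wordSpan s, x * y ∈ wordSpan s) ∧ ∀ y ∈ wordSpan s, star x * y ∈ wordSpan s := by
    intro x hx
    induction hx using StarAlgebra.adjoin_induction with
    | mem x hx =>
      obtain rfl | ⟨f, rfl⟩ := hx
      · exact ⟨fun y => v_mul_mem_wordSpan, fun y => star_v_mul_mem_wordSpan⟩
      · refine ⟨fun y => ι_mul_mem_wordSpan f, fun y => ?_⟩
        rw [← map_star]
        exact ι_mul_mem_wordSpan (star f)
    | algebraMap c =>
      refine ⟨fun y hy => ?_, fun y hy => ?_⟩
      · rw [← Algebra.smul_def]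
        exact Submodule.smul_mem _ c hy
      · rw [← algebraMap_star_comm, ← Algebra.smul_def]
        exact Submodule.smul_mem _ _ hy
    | add x x' _ _ h h' =>
      refine ⟨fun y hy => ?_, fun y hy => ?_⟩
      · rw [add_mul]
        exact add_mem (h.1 y hy) (h'.1 y hy)
      · rw [star_add, add_mul]
        exact add_mem (h.2 y hy) (h'.2 y hy)
    | mul x x' _ _ h h' =>
      refine ⟨fun y hy => ?_, fun y hy => ?_⟩
      · rw [mul_assoc]
        exact h.1 _ (h'.1 y hy)
      · rw [star_mul, mul_assoc]
        exact h'.2 _ (h.2 y hy)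
    | star x _ h => exact ⟨h.2, by rw [star_star]; exact h.1⟩
  have h1 : (1 : HS s) ∈ wordSpan s := by simpa using word_mem (s := s) 0 1
  simpa using (h y hy).1 1 h1

/-- The words span a subspace containing the dense `*`-algebra generated by v and the functions. -/
theorem mem_of_isClosed_of_word_mem (S : Submodule ℂ (HS s)) (hS : IsClosed (S : Set (HS s)))
    (h1 : ∀ n f, HS.ι s f * HS.v s ^ n ∈ S) (h2 : ∀ n f, star (HS.v s) ^ n * HS.ι s f ∈ S)
    (y : HS s) : y ∈ S := by
  have hle : wordSpan s ≤ S := Submodule.span_le.mpr fun y hy => by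
    obtain ⟨n, f, rfl | rfl⟩ := hy
    · exact h1 n f
    · exact h2 n f
  have htop : (StarAlgebra.adjoin ℂ (insert (HS.v s) (Set.range (HS.ι s)))).topologicalClosure = ⊤ :=
    CrossedProduct.eq_top_of_isClosed _ (StarSubalgebra.isClosed_topologicalClosure _)
      (fun b => StarSubalgebra.le_topologicalClosure _
        (StarAlgebra.subset_adjoin ℂ _ (Set.mem_insert_of_mem _ ⟨b, rfl⟩)))
      (StarSubalgebra.le_topologicalClosure _
        (StarAlgebra.subset_adjoin ℂ _ (Set.mem_insert _ _)))
  have hy : y ∈ closure (StarAlgebra.adjoin ℂ (insert (HS.v s) (Set.range (HS.ι s))) :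
      Set (HS s)) := by
    rw [← StarSubalgebra.topologicalClosure_coe, htop]
    trivial
  exact closure_minimal (fun x hx => hle (adjoin_le_wordSpan hx)) hS hy

end NormalForm

end HenselShift

end

/-! ### Gauge-invariant uniqueness: injectivity of `shiftRep` -/

noncomputable section

namespace HenselShift

open ContinuousLinearMap Filter MeasureTheory

/-! ### The gauge action -/

theorem integral_circle_zpow (k : ℤ) (hk : k ≠ 0) :
    ∫ θ in (-Real.pi)..Real.pi, ((Circle.exp θ : ℂ) ^ k) = 0 := by
  have hc : (k : ℂ) * Complex.I ≠ 0 := mul_ne_zero (Int.cast_ne_zero.mpr hk) Complex.I_ne_zero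
  have h : ∀ θ : ℝ, ((Circle.exp θ : ℂ) ^ k) = Complex.exp ((k : ℂ) * Complex.I * θ) := fun θ => by
    rw [Circle.coe_exp, ← Complex.exp_int_mul]
    congr 1
    ring
  simp only [h]
  rw [integral_exp_mul_complex hc]
  -- The antiderivative takes equal values at ±π because the exponents differ by k·2πi.
  have e : (k : ℂ) * Complex.I * (Real.pi : ℝ) =
      (k : ℂ) * Complex.I * ((-Real.pi : ℝ) : ℂ) + k * (2 * Real.pi * Complex.I) := by
    push_cast
    ring
  rw [e, Complex.exp_add, Complex.exp_int_mul_two_pi_mul_I, mul_one, sub_self, zero_div]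

/-- Evaluation at a point of the circle. -/
def circleEval {A : Type*} [CStarAlgebra A] (z : Circle) : C(Circle, A) →⋆ₐ[ℂ] A where
  toFun g := g z
  map_one' := rfl
  map_mul' _ _ := rfl
  map_zero' := rfl
  map_add' _ _ := rfl
  commutes' _ := rfl
  map_star' _ := rfl

/-- The integral of an orbit of an action of the circle on a `C*`-algebra. -/
def circleAverage {A : Type*} [CStarAlgebra A] (γ : A →⋆ₐ[ℂ] C(Circle, A)) : A →L[ℂ] A :=
  have hc : ∀ g : C(Circle, A), Continuous fun θ : ℝ => g (Circle.exp θ) := fun g =>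
    g.continuous.comp Circle.exp.continuous
  have I : C(Circle, A) →L[ℂ] A := LinearMap.mkContinuous
    { toFun := fun g => ∫ θ in (-Real.pi)..Real.pi, g (Circle.exp θ)
      map_add' := fun g h => intervalIntegral.integral_add ((hc g).intervalIntegrable _ _)
        ((hc h).intervalIntegrable _ _)
      map_smul' := fun c g => intervalIntegral.integral_smul c _ }
    |Real.pi - -Real.pi| (fun g => by
      rw [mul_comm]
      exact intervalIntegral.norm_integral_le_of_norm_le_const fun θ _ => g.norm_coe_le_norm _)
  I.comp ⟨γ.toAlgHom.toLinearMap, continuous_starAlgHom γ⟩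

section CircleAverage

variable {A : Type*} [CStarAlgebra A] (γ : A →⋆ₐ[ℂ] C(Circle, A))

theorem circleAverage_apply (y : A) :
    circleAverage γ y = ∫ θ in (-Real.pi)..Real.pi, γ y (Circle.exp θ) := rfl

theorem continuous_orbit_exp (y : A) : Continuous fun θ : ℝ => γ y (Circle.exp θ) :=
  (γ y).continuous.comp Circle.exp.continuous

theorem circleAverage_eq_zero (k : ℤ) (hk : k ≠ 0) (y : A)
    (hy : ∀ z : Circle, γ y z = (z : ℂ) ^ k • y) : circleAverage γ y = 0 := by
  rw [circleAverage_apply]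
  simp only [hy]
  rw [intervalIntegral.integral_smul_const, integral_circle_zpow k hk, zero_smul]

/-- The integral is not normalized, so fixed points are scaled by 2π. -/
theorem circleAverage_eq_smul (y : A) (hy : ∀ z : Circle, γ y z = y) :
    circleAverage γ y = ((2 * Real.pi : ℝ) : ℂ) • y := by
  rw [circleAverage_apply]
  simp only [hy]
  rw [intervalIntegral.integral_const, Complex.coe_smul]
  congr 1
  ring

theorem circleAverage_mul_pow (a v : A) (ha : ∀ z, γ a z = a) (hv : ∀ z : Circle, γ v z = (z : ℂ) • v)
    (n : ℕ) : circleAverage γ (a * v ^ (n + 1)) = 0 := by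
  refine circleAverage_eq_zero γ (n + 1 : ℕ) (Int.natCast_ne_zero.mpr n.succ_ne_zero) _ fun z => ?_
  change ((circleEval z).comp γ) (a * v ^ (n + 1)) = _
  rw [map_mul, map_pow]
  change γ a z * γ v z ^ (n + 1) = _
  rw [ha, hv, smul_pow, mul_smul_comm, zpow_natCast]

theorem circleAverage_star_pow_mul (a v : A) (ha : ∀ z, γ a z = a)
    (hv : ∀ z : Circle, γ v z = (z : ℂ) • v) (n : ℕ) :
    circleAverage γ (star v ^ (n + 1) * a) = 0 := by
  refine circleAverage_eq_zero γ (-(n + 1 : ℕ))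
    (neg_ne_zero.mpr (Int.natCast_ne_zero.mpr n.succ_ne_zero)) _ fun z => ?_
  change ((circleEval z).comp γ) (star v ^ (n + 1) * a) = _
  rw [map_mul, map_pow, map_star]
  change star (γ v z) ^ (n + 1) * γ a z = _
  rw [ha, hv, star_smul, smul_pow, smul_mul_assoc, zpow_neg, zpow_natCast, ← inv_pow,
    RCLike.star_def, ← Circle.coe_inv_eq_conj, Circle.coe_inv]

/-- A continuous linear map commutes with the integral. -/
theorem map_circleAverage_eq_zero {X : Type*} [CStarAlgebra X] (π : A →⋆ₐ[ℂ] X) (y : A)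
    (hy : ∀ z, π (γ y z) = 0) : π (circleAverage γ y) = 0 := by
  let L : A →L[ℂ] X := ⟨π.toAlgHom.toLinearMap, continuous_starAlgHom π⟩
  change L _ = 0
  rw [circleAverage_apply, ← L.intervalIntegral_comp_comm
    ((continuous_orbit_exp γ y).intervalIntegrable _ _)]
  exact (intervalIntegral.integral_congr fun θ _ => hy _).trans intervalIntegral.integral_zero

/-- The average over the orbits of an action of the circle is faithful. -/
theorem eq_zero_of_circleAverage_star_mul_self (hγ : ∀ y, γ y 1 = y) (y : A)
    (hy : circleAverage γ (star y * y) = 0) : y = 0 := by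
  have h1 := eq_zero_of_integral_eq_zero (fun θ : ℝ => γ (star y * y) (Circle.exp θ))
    (continuous_orbit_exp γ _) (neg_lt_zero.mpr Real.pi_pos) Real.pi_pos
    (fun θ => ⟨γ y (Circle.exp θ), by rw [map_mul, map_star]; rfl⟩) hy
  rw [Circle.exp_zero, hγ] at h1
  exact (CStarRing.star_mul_self_eq_zero_iff y).mp h1

end CircleAverage

section Gauge

variable (s : ℕ)

/-- The unitary `E_(n,x) ↦ z ^ n E_(n,x)`. -/
def gaugeUnitary (z : Circle) : unitary (H s →L[ℂ] H s) :=
  -- The coordinate function of the circle, evaluated at z^n, is represented diagonally; it is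
  -- unitary in C(𝕋), hence so is its image.
  ⟨pointRep (fun b : Ball s => z ^ b.1) ⟨fun z : Circle => (z : ℂ), by fun_prop⟩, by
    have h : star (⟨fun z : Circle => (z : ℂ), by fun_prop⟩ : C(Circle, ℂ)) *
        ⟨fun z : Circle => (z : ℂ), by fun_prop⟩ = 1 := by
      ext z
      change star (z : ℂ) * z = 1
      rw [RCLike.star_def, Complex.conj_mul', Circle.norm_coe]
      simp
    rw [Unitary.mem_iff, ← map_star, ← map_mul, ← map_mul, mul_comm _ (star _), h, map_one]
    exact ⟨rfl, rfl⟩⟩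

theorem gaugeUnitary_E (z : Circle) (b : Ball s) :
    (gaugeUnitary s z : H s →L[ℂ] H s) (E b) = (z : ℂ) ^ b.1 • E b := by
  refine (pointRep_E _ _ b).trans ?_
  change ((z ^ b.1 : Circle) : ℂ) • E b = _
  rw [Circle.coe_pow]

variable [NeZero s]

/-- The covariant pair `(f, z ↦ z v)` in `C(𝕋, HS(s))`. -/
def gaugePair : CovariantPair (aV s) C(Circle, HS s) where
  π :=
    { toFun := fun f => ContinuousMap.const Circle (HS.ι s f)
      map_one' := by ext1 z; exact map_one (HS.ι s)
      map_mul' := fun f g => by ext1 z; exact map_mul (HS.ι s) f g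
      map_zero' := by ext1 z; exact map_zero (HS.ι s)
      map_add' := fun f g => by ext1 z; exact map_add (HS.ι s) f g
      commutes' := fun c => by ext1 z; exact AlgHomClass.commutes (HS.ι s) c
      map_star' := fun f => by ext1 z; exact map_star (HS.ι s) f }
  v := ⟨fun z => (z : ℂ) • HS.v s, by fun_prop⟩
  isometry := by
    ext1 z
    change star ((z : ℂ) • HS.v s) * ((z : ℂ) • HS.v s) = 1
    have h : star (HS.v s) * HS.v s = 1 := (CrossedProduct.pair (aV s)).isometry
    rw [star_smul, smul_mul_smul_comm, h, RCLike.star_def, Complex.conj_mul', Circle.norm_coe]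
    simp
  covariant f := by
    ext1 z
    change ((z : ℂ) • HS.v s) * HS.ι s f * star ((z : ℂ) • HS.v s) = HS.ι s (aV s f)
    have h : HS.v s * HS.ι s f * star (HS.v s) = HS.ι s (aV s f) :=
      (CrossedProduct.pair (aV s)).covariant f
    rw [star_smul, smul_mul_assoc, smul_mul_smul_comm, h, RCLike.star_def, Complex.mul_conj',
      Circle.norm_coe]
    simp

/-- The gauge action, as a `*`-homomorphism `HS(s) → C(𝕋, HS(s))`. -/
def gauge : HS s →⋆ₐ[ℂ] C(Circle, HS s) :=
  (CrossedProduct.existsUnique_lift (aV s) (gaugePair s)).choose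

theorem gauge_ι (f : C(SAdicInt s, ℂ)) (z : Circle) : gauge s (HS.ι s f) z = HS.ι s f :=
  congrArg (fun g : C(Circle, HS s) => g z)
    ((CrossedProduct.existsUnique_lift (aV s) (gaugePair s)).choose_spec.1.1 f)

theorem gauge_v (z : Circle) : gauge s (HS.v s) z = (z : ℂ) • HS.v s :=
  congrArg (fun g : C(Circle, HS s) => g z)
    (CrossedProduct.existsUnique_lift (aV s) (gaugePair s)).choose_spec.1.2

/-- Evaluation of the gauge action at a point of the circle. -/
def gaugeAt (z : Circle) : HS s →⋆ₐ[ℂ] HS s :=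
  (circleEval z).comp (gauge s)

theorem gaugeAt_one : gaugeAt s 1 = StarAlgHom.id ℂ (HS s) :=
  CrossedProduct.hom_ext (fun f => gauge_ι s f 1)
    ((gauge_v s 1).trans (by rw [Circle.coe_one, one_smul]; rfl))

/-- `V s` raises the level by one and diagonal operators preserve it, so conjugation by the
level-grading unitary implements the gauge action. The kernel of `shiftRep` is therefore gauge
invariant. -/
theorem shiftRep_gaugeAt (hs : 2 ≤ s) (z : Circle) :
    (shiftRep s hs).comp (gaugeAt s z) =
      (Unitary.conjStarAlgAut ℂ _ (gaugeUnitary s z) :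
        (H s →L[ℂ] H s) →⋆ₐ[ℂ] (H s →L[ℂ] H s)).comp (shiftRep s hs) := by
  have key : ∀ S T : H s →L[ℂ] H s, T * gaugeUnitary s z = gaugeUnitary s z * S →
      T = Unitary.conjStarAlgAut ℂ _ (gaugeUnitary s z) S := fun S T h => by
    rw [Unitary.conjStarAlgAut_apply, ← h, mul_assoc, Unitary.mul_star_self_of_mem (Subtype.prop _),
      mul_one]
  refine CrossedProduct.hom_ext (fun f => key _ _ ?_) (key _ _ ?_)
  · change shiftRep s hs (gauge s (HS.ι s f) z) * _ = _ * shiftRep s hs (HS.ι s f)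
    rw [gauge_ι, shiftRep_ι]
    refine clm_ext_E fun b => ?_
    rw [mul_apply_eq_comp, mul_apply_eq_comp, gaugeUnitary_E, pointRep_E, map_smul, map_smul,
      gaugeUnitary_E, pointRep_E, smul_comm]
  · change shiftRep s hs (gauge s (HS.v s) z) * _ = _ * shiftRep s hs (HS.v s)
    rw [gauge_v, map_smul, shiftRep_v]
    refine clm_ext_E fun b => ?_
    rw [mul_apply_eq_comp, mul_apply_eq_comp, gaugeUnitary_E, V_E, map_smul, gaugeUnitary_E,
      smul_apply, V_E, smul_smul]
    congr 1

/-- The average over the gauge action. -/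
def gaugeAverage : HS s →L[ℂ] HS s := circleAverage (gauge s)

theorem gaugeAverage_ι (f : C(SAdicInt s, ℂ)) :
    gaugeAverage s (HS.ι s f) = HS.ι s (((2 * Real.pi : ℝ) : ℂ) • f) := by
  rw [map_smul]
  exact circleAverage_eq_smul (gauge s) _ (gauge_ι s f)

theorem gaugeAverage_word (f : C(SAdicInt s, ℂ)) (n : ℕ) :
    gaugeAverage s (HS.ι s f * HS.v s ^ (n + 1)) = 0 :=
  circleAverage_mul_pow (gauge s) (HS.ι s f) (HS.v s) (gauge_ι s f) (gauge_v s) n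

theorem gaugeAverage_star_word (f : C(SAdicInt s, ℂ)) (n : ℕ) :
    gaugeAverage s (star (HS.v s) ^ (n + 1) * HS.ι s f) = 0 :=
  circleAverage_star_pow_mul (gauge s) (HS.ι s f) (HS.v s) (gauge_ι s f) (gauge_v s) n

theorem ι_injective (hs : 2 ≤ s) : Function.Injective (HS.ι s) := fun f g h => by
  have h' := congrArg (shiftRep s hs) h
  rw [shiftRep_ι, shiftRep_ι] at h'
  exact pointRep_injective _ (denseRange_positiveCenter s hs) h'

/-- On words the average keeps only degree zero, where the word is a function. -/
theorem gaugeAverage_mem_range (hs : 2 ≤ s) (y : HS s) :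
    gaugeAverage s y ∈ Set.range (HS.ι s) := by
  let R : Submodule ℂ (HS s) := LinearMap.range (HS.ι s).toAlgHom.toLinearMap
  -- An injective `*`-homomorphism is isometric, so its range is closed.
  have hR : IsClosed (R : Set (HS s)) :=
    (NonUnitalStarAlgHom.isometry (HS.ι s) (ι_injective s hs)).isClosedEmbedding.isClosed_range
  refine mem_of_isClosed_of_word_mem (R.comap (gaugeAverage s).toLinearMap)
    (hR.preimage (gaugeAverage s).continuous) (fun n f => ?_) (fun n f => ?_) y
  · change gaugeAverage s _ ∈ R
    cases n with
    | zero =>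
      rw [pow_zero, mul_one, gaugeAverage_ι]
      exact ⟨_, rfl⟩
    | succ n =>
      rw [gaugeAverage_word]
      exact zero_mem R
  · change gaugeAverage s _ ∈ R
    cases n with
    | zero =>
      rw [pow_zero, one_mul, gaugeAverage_ι]
      exact ⟨_, rfl⟩
    | succ n =>
      rw [gaugeAverage_star_word]
      exact zero_mem R

theorem gaugeAverage_eq_zero_of_shiftRep (hs : 2 ≤ s) (y : HS s) (hy : shiftRep s hs y = 0) :
    gaugeAverage s y = 0 := by
  have h0 : shiftRep s hs (gaugeAverage s y) = 0 := by
    refine map_circleAverage_eq_zero (gauge s) (shiftRep s hs) y fun z => ?_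
    have h := congrArg (fun φ : HS s →⋆ₐ[ℂ] (H s →L[ℂ] H s) => φ y) (shiftRep_gaugeAt s hs z)
    refine h.trans ?_
    change Unitary.conjStarAlgAut ℂ _ (gaugeUnitary s z) (shiftRep s hs y) = 0
    rw [hy, map_zero]
  obtain ⟨f, hf⟩ := gaugeAverage_mem_range s hs y
  rw [← hf] at h0 ⊢
  have h1 : pointRep _ f = 0 := (shiftRep_ι s hs f).symm.trans h0
  rw [pointRep_injective _ (denseRange_positiveCenter s hs) (h1.trans (map_zero _).symm), map_zero]

/-- For y in the kernel, the average of y*y vanishes, and the average is faithful on such elements.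
-/
theorem shiftRep_injective (hs : 2 ≤ s) : Function.Injective (shiftRep s hs) := by
  rw [injective_iff_map_eq_zero]
  intro y hy
  exact eq_zero_of_circleAverage_star_mul_self (gauge s)
    (fun x => congrArg (fun φ : HS s →⋆ₐ[ℂ] HS s => φ x) (gaugeAt_one s)) y
    (gaugeAverage_eq_zero_of_shiftRep s hs _ (by rw [map_mul, hy, mul_zero]))

end Gauge

end HenselShift

end

/-! ### The zero orbit and its compact operators inside A_V -/

noncomputable section

namespace HenselShift

open InnerProductSpace ContinuousLinearMap Filter

/-! ### Operators along an orbit of the shift -/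

section OrbitOperators

variable {s : ℕ} [NeZero s] {j : ℕ → Ball s} (hj : Function.Injective j)

/-- The unilateral shift. -/
def unilateralShift : ℓ²(ℕ, ℂ) →L[ℂ] ℓ²(ℕ, ℂ) := basisMap Nat.succ Nat.succ_injective

theorem V_comp_basisMap (h : ∀ k, shiftBall s (j k) = j (k + 1)) :
    V s ∘L basisMap j hj = basisMap j hj ∘L unilateralShift :=
  clm_ext_E fun k => by
    rw [comp_apply, comp_apply, unilateralShift, basisMap_E, basisMap_E, V_E, h, basisMap_E]

/-- At k = 0 both sides vanish: `j 0` is not a shift, just as 0 is not a successor. -/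
theorem star_V_comp_basisMap (h : ∀ k, shiftBall s (j k) = j (k + 1))
    (h0 : ∀ b, shiftBall s b ≠ j 0) :
    star (V s) ∘L basisMap j hj = basisMap j hj ∘L adjoint unilateralShift :=
  clm_ext_E fun k => by
    rw [comp_apply, comp_apply, unilateralShift, basisMap_E]
    cases k with
    | zero =>
      rw [star_V_E_of_ne s _ h0, adjoint_basisMap_E_of_notMem _ _ _ fun k => k.succ_ne_zero,
        map_zero]
    | succ k =>
      rw [← h, star_V_E_shiftBall, adjoint_basisMap_E Nat.succ Nat.succ_injective k, basisMap_E]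

theorem adjoint_basisMap_comp_V (h : ∀ k, shiftBall s (j k) = j (k + 1))
    (h0 : ∀ b, shiftBall s b ≠ j 0) :
    adjoint (basisMap j hj) ∘L V s = unilateralShift ∘L adjoint (basisMap j hj) := by
  have e := congrArg adjoint (star_V_comp_basisMap hj h h0)
  simpa only [star_eq_adjoint, adjoint_comp, adjoint_adjoint] using e

/-- The orbit span is invariant under V and V*, hence reducing. -/
theorem rangeProjection_mul_V (h : ∀ k, shiftBall s (j k) = j (k + 1))
    (h0 : ∀ b, shiftBall s b ≠ j 0) :
    (basisMap j hj ∘L adjoint (basisMap j hj)) * V s =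
      V s * (basisMap j hj ∘L adjoint (basisMap j hj)) := by
  change (basisMap j hj ∘L adjoint (basisMap j hj)) ∘L V s =
    V s ∘L (basisMap j hj ∘L adjoint (basisMap j hj))
  rw [comp_assoc, adjoint_basisMap_comp_V hj h h0, ← comp_assoc, ← comp_assoc,
    V_comp_basisMap hj h]

theorem rangeProjection_mul_pointRep (c : Ball s → SAdicInt s) (f : C(SAdicInt s, ℂ)) :
    (basisMap j hj ∘L adjoint (basisMap j hj)) * pointRep c f =
      pointRep c f * (basisMap j hj ∘L adjoint (basisMap j hj)) :=
  clm_ext_E fun b => by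
    simp only [mul_apply_eq_comp, comp_apply, pointRep_E, map_smul]
    by_cases hb : ∃ k, j k = b
    · obtain ⟨k, rfl⟩ := hb
      rw [adjoint_basisMap_E j hj k, basisMap_E, pointRep_E]
    · push Not at hb
      rw [adjoint_basisMap_E_of_notMem j hj b hb, map_zero, map_zero, smul_zero]

theorem compression_V (h : ∀ k, shiftBall s (j k) = j (k + 1)) :
    adjoint (basisMap j hj) ∘L V s ∘L basisMap j hj = unilateralShift := by
  rw [V_comp_basisMap hj h, ← comp_assoc, adjoint_basisMap_comp]
  rfl

theorem compression_pointRep (c : Ball s → SAdicInt s) (f : C(SAdicInt s, ℂ)) :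
    adjoint (basisMap j hj) ∘L pointRep c f ∘L basisMap j hj = pointRep (c ∘ j) f :=
  clm_ext_E fun k => by
    rw [comp_apply, comp_apply, basisMap_E, pointRep_E, map_smul, adjoint_basisMap_E j hj k,
      pointRep_E]
    rfl

end OrbitOperators

/-! ### The two orbit isometries and the ideal of compact operators -/

section Ideal

variable (s : ℕ) [NeZero s]

/-- The isometry `E_k ↦ E_(k,0)`. -/
def J₀ : ℓ²(ℕ, ℂ) →L[ℂ] H s := basisMap (zeroBall s) (zeroBall_injective s)

theorem adjoint_J₀_comp_J₀ : adjoint (J₀ s) ∘L J₀ s = 1 := adjoint_basisMap_comp _ _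

theorem V_pow_E_zeroBall (k : ℕ) : (V s ^ k) (E (zeroBall s 0)) = E (zeroBall s k) := by
  induction k with
  | zero => rfl
  | succ k ih => rw [pow_succ', mul_apply_eq_comp, ih, V_E, shiftBall_zeroBall]

theorem P00_eq_rankOne : P00 s = rankOne ℂ (E (zeroBall s 0)) (E (zeroBall s 0)) := by
  ext1 ξ
  exact (Submodule.starProjection_unit_singleton ℂ (norm_E _) ξ).trans (rankOne_apply _ _ _).symm

theorem conjHom_matrixUnit (k l : ℕ) :
    conjHom (J₀ s) (adjoint_J₀_comp_J₀ s) (matrixUnit k l).1 = PTilde s k l := by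
  have h1 : conjHom (J₀ s) (adjoint_J₀_comp_J₀ s) (matrixUnit k l).1 =
      rankOne ℂ (E (zeroBall s k)) (E (zeroBall s l)) := by
    rw [conjHom_apply, matrixUnit, rankOne_comp, comp_rankOne, adjoint_adjoint, J₀, basisMap_E,
      basisMap_E]
  rw [h1, PTilde, P00_eq_rankOne, ← star_pow]
  change _ = ((V s ^ k) ∘L rankOne ℂ _ _) ∘L adjoint (V s ^ l)
  rw [comp_rankOne, rankOne_comp, adjoint_adjoint, V_pow_E_zeroBall, V_pow_E_zeroBall]

/-- The compact operators on the closed span of the `E_(k,0)`. -/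
def orbitCompacts : NonUnitalStarSubalgebra ℂ (H s →L[ℂ] H s) :=
  NonUnitalStarAlgHom.range ((conjHom (J₀ s) (adjoint_J₀_comp_J₀ s)).comp
    (NonUnitalStarSubalgebraClass.subtype K))

theorem mem_orbitCompacts_iff {T : H s →L[ℂ] H s} : T ∈ orbitCompacts s ↔
    ∃ c : K, conjHom (J₀ s) (adjoint_J₀_comp_J₀ s) c.1 = T := Iff.rfl

theorem isClosed_orbitCompacts : IsClosed (orbitCompacts s : Set (H s →L[ℂ] H s)) :=
  (NonUnitalStarAlgHom.isometry ((conjHom (J₀ s) (adjoint_J₀_comp_J₀ s)).comp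
    (NonUnitalStarSubalgebraClass.subtype K))
    ((conjHom_injective _ (adjoint_J₀_comp_J₀ s)).comp Subtype.val_injective)).isClosedEmbedding.isClosed_range

theorem PTilde_mem_orbitCompacts (k l : ℕ) : PTilde s k l ∈ orbitCompacts s :=
  ⟨matrixUnit k l, conjHom_matrixUnit s k l⟩

/-- Pull the subspace back along the isometric map T ↦ J₀TJ₀*; matrix units span a dense subspace of
𝒦. -/
theorem orbitCompacts_le_of_PTilde_mem (S : Submodule ℂ (H s →L[ℂ] H s))
    (hS : IsClosed (S : Set (H s →L[ℂ] H s))) (h : ∀ k l, PTilde s k l ∈ S)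
    {T : H s →L[ℂ] H s} (hT : T ∈ orbitCompacts s) : T ∈ S := by
  obtain ⟨c, rfl⟩ := hT
  let L : (ℓ²(ℕ, ℂ) →L[ℂ] ℓ²(ℕ, ℂ)) →ₗ[ℂ] (H s →L[ℂ] H s) :=
    { toFun := conjHom (J₀ s) (adjoint_J₀_comp_J₀ s)
      map_add' := map_add _
      map_smul' := map_smul _ }
  refine compact_mem_of_matrixUnit_mem (S.comap L) (hS.preimage ?_) (fun k l => ?_) c.1 c.2
  · exact (NonUnitalStarAlgHom.isometry _ (conjHom_injective _ (adjoint_J₀_comp_J₀ s))).continuous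
  · change conjHom (J₀ s) (adjoint_J₀_comp_J₀ s) _ ∈ S
    rw [conjHom_matrixUnit]
    exact h k l

theorem matrixUnitAlgebra_eq : matrixUnitAlgebra s = orbitCompacts s := by
  refine le_antisymm ?_ fun T => ?_
  · refine NonUnitalStarSubalgebra.topologicalClosure_minimal _
      (NonUnitalStarAlgebra.adjoin_le ?_) (isClosed_orbitCompacts s)
    rintro _ ⟨k, l, rfl⟩
    exact PTilde_mem_orbitCompacts s k l
  · refine orbitCompacts_le_of_PTilde_mem s (matrixUnitAlgebra s).toSubmodule
      (NonUnitalStarSubalgebra.isClosed_topologicalClosure _) fun k l => ?_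
    exact NonUnitalStarSubalgebra.le_topologicalClosure _
      (NonUnitalStarAlgebra.subset_adjoin ℂ _ ⟨k, l, rfl⟩)

/-- From J₀*V = SJ₀*, with S the unilateral shift, a factor V is absorbed into the compact operator.
-/
theorem mul_V_pow_mem_orbitCompacts {T : H s →L[ℂ] H s} (hT : T ∈ orbitCompacts s) (n : ℕ) :
    T * V s ^ n ∈ orbitCompacts s := by
  induction n with
  | zero => rwa [pow_zero, mul_one]
  | succ n ih =>
    rw [pow_succ, ← mul_assoc]
    obtain ⟨c, hc⟩ := (mem_orbitCompacts_iff s).mp ih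
    rw [← hc]
    refine (mem_orbitCompacts_iff s).mpr ⟨⟨c.1 * unilateralShift,
      IsCompactOperator.comp_clm c.2 unilateralShift⟩, ?_⟩
    have h := adjoint_basisMap_comp_V (zeroBall_injective s) (shiftBall_zeroBall s)
      (shiftBall_ne_zeroBall s)
    change J₀ s ∘L (c.1 ∘L unilateralShift) ∘L adjoint (J₀ s) =
      (J₀ s ∘L c.1 ∘L adjoint (J₀ s)) ∘L V s
    simp only [comp_assoc]
    rw [J₀, h]

/-- Multiplying V^(l+m) P V*^(l+m) by V^m cancels m of the adjoints, producing the matrix units on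
and below the diagonal; adjoints supply the others. -/
theorem IdealV_eq : IdealV s = orbitCompacts s := by
  have hI : ∀ n, V s ^ n * P00 s * star (V s) ^ n ∈ IV s := fun n =>
    NonUnitalStarSubalgebra.le_topologicalClosure _
      (NonUnitalStarAlgebra.subset_adjoin ℂ _ ⟨n, rfl⟩)
  refine le_antisymm ?_ fun T => ?_
  · refine NonUnitalStarSubalgebra.topologicalClosure_minimal _
      (NonUnitalStarAlgebra.adjoin_le ?_) (isClosed_orbitCompacts s)
    rintro _ ⟨a, ha, n, rfl⟩
    refine mul_V_pow_mem_orbitCompacts s ?_ n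
    refine NonUnitalStarSubalgebra.topologicalClosure_minimal _
      (NonUnitalStarAlgebra.adjoin_le ?_) (isClosed_orbitCompacts s) ha
    rintro _ ⟨n, rfl⟩
    exact PTilde_mem_orbitCompacts s n n
  · have hle : ∀ l m, PTilde s (l + m) l ∈ IdealV s := fun l m => by
      refine NonUnitalStarSubalgebra.le_topologicalClosure _
        (NonUnitalStarAlgebra.subset_adjoin ℂ _ ⟨_, hI (l + m), m, ?_⟩)
      have h : star (V s) ^ m * V s ^ m = 1 := by
        induction m with
        | zero => simp
        | succ m ih =>
          rw [pow_succ, pow_succ', mul_assoc, ← mul_assoc _ (V s), star_V_mul_V, one_mul, ih]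
      rw [PTilde, pow_add (star (V s)), mul_assoc _ _ (V s ^ m), mul_assoc _ _ (V s ^ m), h,
        mul_one]
    have hstar : ∀ k l, star (PTilde s k l) = PTilde s l k := fun k l => by
      have hP : star (P00 s) = P00 s := by
        rw [P00_eq_rankOne, star_eq_adjoint, adjoint_rankOne]
      rw [PTilde, PTilde, star_mul, star_mul, hP, star_pow, star_pow, star_star, mul_assoc]
    refine orbitCompacts_le_of_PTilde_mem s (IdealV s).toSubmodule
      (NonUnitalStarSubalgebra.isClosed_topologicalClosure _) fun k l => ?_
    change PTilde s k l ∈ IdealV s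
    obtain h | h := le_total l k
    · obtain ⟨m, rfl⟩ := Nat.exists_eq_add_of_le h
      exact hle l m
    · obtain ⟨m, rfl⟩ := Nat.exists_eq_add_of_le h
      rw [← hstar]
      exact star_mem (hle k m)

/-- `aV s 1` is the indicator of sℤ_s, and (0,0) is the only ball with centre in sℤ_s that is not a
shift. -/
theorem P00_mem_AV (hs : 2 ≤ s) : P00 s ∈ AV s := by
  have h : P00 s = M s (aV s 1) - V s * star (V s) := by
    refine clm_ext_E fun b => ?_
    rw [sub_apply, mul_apply_eq_comp, M_E, P00_eq_rankOne, rankOne_apply]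
    change _ = aVFun s _ _ • _ - _
    by_cases hb : ∃ c, shiftBall s c = b
    · obtain ⟨c, rfl⟩ := hb
      have hc : ((((shiftBall s c).2 : ℕ) : SAdicInt s)) = s * ((c.2 : ℕ) : SAdicInt s) :=
        Nat.cast_mul _ _
      rw [star_V_E_shiftBall, V_E, hc, aVFun_mul, inner_E, E_apply,
        if_neg (shiftBall_ne_zeroBall s c).symm]
      simp
    · push Not at hb
      rw [star_V_E_of_ne s b hb, map_zero, sub_zero]
      obtain ⟨k, rfl⟩ | h := eq_zeroBall_or_ne s b
      · cases k with
        | zero =>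
          have h0 : (((zeroBall s 0).2 : ℕ) : SAdicInt s) = s * 0 :=
            Nat.cast_zero.trans (mul_zero _).symm
          rw [h0, aVFun_mul, inner_E, E_apply, if_pos rfl]
          rfl
        | succ k => exact absurd (shiftBall_zeroBall s k) (hb _)
      · have hd := not_dvd_positiveCenter s hs b hb
        rw [positiveCenter_of_ne s h] at hd
        have hne : zeroBall s 0 ≠ b := fun hb => h (hb ▸ rfl)
        rw [aVFun_of_not_dvd s _ _ hd, inner_E, E_apply, if_neg hne, zero_smul, zero_smul]
  rw [h]
  exact sub_mem (M_mem_AV s _) (mul_mem (V_mem_AV s) (star_mem (V_mem_AV s)))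

theorem orbitCompacts_le_AV (hs : 2 ≤ s) {T : H s →L[ℂ] H s} (hT : T ∈ orbitCompacts s) :
    T ∈ AV s :=
  have h : ∀ k l, PTilde s k l ∈ AV s := fun _ _ =>
    mul_mem (mul_mem (pow_mem (V_mem_AV s) _) (P00_mem_AV s hs))
      (pow_mem (star_mem (V_mem_AV s)) _)
  orbitCompacts_le_of_PTilde_mem s (AV s).toSubalgebra.toSubmodule (isClosed_AV s) h hT

end Ideal

end HenselShift

end

/-! ### Replacing the zero orbit by the orbit of (1,1) -/

noncomputable section

namespace HenselShift

open InnerProductSpace ContinuousLinearMap Filter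

/-! ### The retraction of `A_V` onto the image of `HS(s)` -/

section Retraction

variable (s : ℕ) (hs : 2 ≤ s)

/-- The isometry `E_k ↦ E_(k+1, s^k)`. -/
def J₁ : ℓ²(ℕ, ℂ) →L[ℂ] H s := basisMap (oneBall s hs) (oneBall_injective s hs)

theorem adjoint_J₁_comp_J₁ : adjoint (J₁ s hs) ∘L J₁ s hs = 1 := adjoint_basisMap_comp _ _

variable [NeZero s]

theorem adjoint_J₀_comp_J₁ : adjoint (J₀ s) ∘L J₁ s hs = 0 :=
  clm_ext_E fun k => by
    rw [comp_apply, J₁, basisMap_E]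
    exact adjoint_basisMap_E_of_notMem _ (zeroBall_injective s) _
      fun l => (oneBall_ne_zeroBall s hs k l).symm

/-- The partial isometry `E_(k,0) ↦ E_(k+1, s^k)`. -/
def W : H s →L[ℂ] H s := J₁ s hs ∘L adjoint (J₀ s)

theorem star_W : star (W s hs) = J₀ s ∘L adjoint (J₁ s hs) := by
  rw [W, star_eq_adjoint, adjoint_comp, adjoint_adjoint]

theorem star_W_mul_W : star (W s hs) * W s hs = J₀ s ∘L adjoint (J₀ s) := by
  rw [star_W]
  change (J₀ s ∘L adjoint (J₁ s hs)) ∘L (J₁ s hs ∘L adjoint (J₀ s)) = _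
  rw [comp_assoc, ← comp_assoc _ (J₁ s hs), adjoint_J₁_comp_J₁]
  rfl

theorem W_mul_star_W : W s hs * star (W s hs) = J₁ s hs ∘L adjoint (J₁ s hs) := by
  rw [star_W]
  change (J₁ s hs ∘L adjoint (J₀ s)) ∘L (J₀ s ∘L adjoint (J₁ s hs)) = _
  rw [comp_assoc, ← comp_assoc _ (J₀ s), adjoint_J₀_comp_J₀]
  rfl

theorem W_mul_star_W_mul_W : W s hs * star (W s hs) * W s hs = W s hs := by
  rw [W_mul_star_W]
  change (J₁ s hs ∘L adjoint (J₁ s hs)) ∘L (J₁ s hs ∘L adjoint (J₀ s)) = _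
  rw [comp_assoc, ← comp_assoc _ (J₁ s hs), adjoint_J₁_comp_J₁]
  rfl

theorem W_E_zeroBall (k : ℕ) : W s hs (E (zeroBall s k)) = E (oneBall s hs k) := by
  rw [W, comp_apply, J₀, adjoint_basisMap_E _ (zeroBall_injective s) k, J₁, basisMap_E]

theorem star_W_E_oneBall (k : ℕ) : star (W s hs) (E (oneBall s hs k)) = E (zeroBall s k) := by
  rw [star_W, comp_apply, J₁, adjoint_basisMap_E _ (oneBall_injective s hs) k, J₀, basisMap_E]

theorem W_E_of_ne {b : Ball s} (hb : (b.2 : ℕ) ≠ 0) : W s hs (E b) = 0 := by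
  rw [W, comp_apply, J₀, adjoint_basisMap_E_of_notMem _ (zeroBall_injective s) b, map_zero]
  exact fun k h => hb (h ▸ rfl)

/-- V acts as the same unilateral shift on both orbits, and the zero orbit is reducing. -/
theorem W_mul_V : W s hs * V s = V s * W s hs := by
  have h0 := adjoint_basisMap_comp_V (zeroBall_injective s) (shiftBall_zeroBall s)
    (shiftBall_ne_zeroBall s)
  have h1 := V_comp_basisMap (oneBall_injective s hs) (shiftBall_oneBall s hs)
  change (J₁ s hs ∘L adjoint (J₀ s)) ∘L V s = V s ∘L (J₁ s hs ∘L adjoint (J₀ s))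
  rw [comp_assoc, J₀, h0, ← comp_assoc, ← comp_assoc, J₁, h1]

/-- The two compressions of V coincide; those of `M s f` differ by the diagonal operator with
entries f(0) - f(s^k), compact because s^k tends to 0 in ℤ_s. -/
theorem AV_le_asymptoticAlgebra : AV s ≤
    asymptoticAlgebra (J₀ s) (J₁ s hs) (adjoint_J₀_comp_J₀ s) (adjoint_J₁_comp_J₁ s hs) := by
  refine StarSubalgebra.topologicalClosure_minimal (StarAlgebra.adjoin_le ?_)
    (isClosed_asymptoticAlgebra _ _ _ _)
  have hsa : ∀ J : ℓ²(ℕ, ℂ) →L[ℂ] H s, star (J ∘L adjoint J) = J ∘L adjoint J := fun J => by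
    rw [star_eq_adjoint, adjoint_comp, adjoint_adjoint]
  have hcent : ∀ T : H s →L[ℂ] H s, (J₀ s ∘L adjoint (J₀ s)) * T = T * (J₀ s ∘L adjoint (J₀ s)) →
      (J₁ s hs ∘L adjoint (J₁ s hs)) * T = T * (J₁ s hs ∘L adjoint (J₁ s hs)) →
      T ∈ StarSubalgebra.centralizer ℂ
        {J₀ s ∘L adjoint (J₀ s), J₁ s hs ∘L adjoint (J₁ s hs)} := fun T h0 h1 => by
    rw [StarSubalgebra.mem_centralizer_iff]
    rintro _ (rfl | rfl)
    · exact ⟨h0, by rw [hsa]; exact h0⟩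
    · exact ⟨h1, by rw [hsa]; exact h1⟩
  rintro T (rfl | ⟨f, rfl⟩)
  · refine ⟨hcent _ (rangeProjection_mul_V _ (shiftBall_zeroBall s) (shiftBall_ne_zeroBall s))
      (rangeProjection_mul_V _ (shiftBall_oneBall s hs) (shiftBall_ne_oneBall s hs)), ?_⟩
    rw [J₀, J₁, compression_V _ (shiftBall_zeroBall s), compression_V _ (shiftBall_oneBall s hs),
      sub_self]
    exact zero_mem _
  · rw [M_eq_pointRep]
    refine ⟨hcent _ (rangeProjection_mul_pointRep _ _ f) (rangeProjection_mul_pointRep _ _ f), ?_⟩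
    rw [J₀, J₁, compression_pointRep, compression_pointRep]
    change diagHom ℕ _ - diagHom ℕ _ ∈ _
    rw [← map_sub]
    refine isCompactOperator_diagHom _ ?_
    change Tendsto (fun k : ℕ => f ((0 : ℕ) : SAdicInt s) - f ((s ^ k : ℕ) : SAdicInt s)) atTop
      (nhds 0)
    have h := (f.continuous.tendsto 0).comp (tendsto_pow s)
    simpa using (tendsto_const_nhds (x := f 0)).sub h

theorem AV_le_centralizer : AV s ≤
    StarSubalgebra.centralizer ℂ {star (W s hs) * W s hs, W s hs * star (W s hs)} := by
  rw [star_W_mul_W, W_mul_star_W]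
  exact fun T hT => (AV_le_asymptoticAlgebra s hs hT).1

/-- The retraction of `A_V` onto the image of `HS(s)`, which replaces the restriction of an operator
to the orbit of `(0, 0)` by its restriction to the orbit of `(1, 1)`. -/
def retraction : AV s →⋆ₐ[ℂ] (H s →L[ℂ] H s) :=
  (replaceHom (W s hs) (W_mul_star_W_mul_W s hs)).comp
    (StarSubalgebra.inclusion (AV_le_centralizer s hs))

theorem retraction_apply (a : AV s) : retraction s hs a =
    (1 - star (W s hs) * W s hs) * a.1 + star (W s hs) * a.1 * W s hs := rfl

theorem sub_retraction_mem (a : AV s) : a.1 - retraction s hs a ∈ orbitCompacts s := by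
  have ha := AV_le_asymptoticAlgebra s hs a.2
  have hc := (StarSubalgebra.mem_centralizer_iff ℂ).mp ha.1 _ (Set.mem_insert _ _)
  rw [retraction_apply, sub_replace_eq_conjHom (J₀ s) (J₁ s hs) (adjoint_J₀_comp_J₀ s)
    (adjoint_J₁_comp_J₁ s hs) (W s hs) rfl a.1 hc.1]
  exact (mem_orbitCompacts_iff s).mpr ⟨⟨_, ha.2⟩, rfl⟩

theorem retraction_V : retraction s hs ⟨V s, V_mem_AV s⟩ = V s := by
  rw [retraction_apply, mul_assoc (star _), ← W_mul_V, ← mul_assoc, ← add_mul, sub_add_cancel,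
    one_mul]

/-- The labels of the balls (n,0) are overwritten, so `c` is arbitrary there. The original centres
give the value on `M s f`, and `positiveCenter` shows that the image of `shiftRep` is fixed. -/
theorem retraction_pointRep (c : Ball s → ℕ) (hc : ∀ b : Ball s, (b.2 : ℕ) ≠ 0 → c b = b.2)
    (f : C(SAdicInt s, ℂ)) (hf : pointRep (fun b => (c b : SAdicInt s)) f ∈ AV s) :
    retraction s hs ⟨_, hf⟩ =
      pointRep (fun b : Ball s => (positiveCenter s b : SAdicInt s)) f := by
  refine clm_ext_E fun b => ?_
  rw [retraction_apply, sub_mul, one_mul]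
  simp only [add_apply, sub_apply, mul_apply_eq_comp, pointRep_E, map_smul]
  obtain ⟨k, rfl⟩ | h := eq_zeroBall_or_ne s b
  · have h1 : ((oneBall s hs k).2 : ℕ) ≠ 0 :=
      (Nat.pow_pos (Nat.pos_of_ne_zero (NeZero.ne s))).ne'
    rw [W_E_zeroBall, star_W_E_oneBall, pointRep_E, map_smul, star_W_E_oneBall, sub_self, zero_add,
      hc _ h1, positiveCenter_zeroBall]
    rfl
  · rw [W_E_of_ne s hs h, map_zero, map_zero, map_zero, smul_zero, sub_zero, add_zero, hc b h,
      positiveCenter_of_ne s h]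

theorem retraction_M (f : C(SAdicInt s, ℂ)) :
    retraction s hs ⟨M s f, M_mem_AV s f⟩ = shiftRep s hs (HS.ι s f) := by
  have h := M_mem_AV s f
  have key := retraction_pointRep s hs (fun b => (b.2 : ℕ)) (fun _ _ => rfl) f
    (M_eq_pointRep s f ▸ h)
  rw [shiftRep_ι, ← key]
  congr 2

theorem retraction_mem_range (a : AV s) : retraction s hs a ∈ (shiftRep s hs).range := by
  have hcl : IsClosed ((shiftRep s hs).range : Set (H s →L[ℂ] H s)) :=
    (NonUnitalStarAlgHom.isometry (shiftRep s hs)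
      (shiftRep_injective s hs)).isClosedEmbedding.isClosed_range
  -- The elements of A_V with the desired property, viewed in B(H): a closed `*`-subalgebra, so the
  -- generators suffice.
  let S : StarSubalgebra ℂ (H s →L[ℂ] H s) :=
    ((shiftRep s hs).range.comap (retraction s hs)).map (AV s).subtype
  have hS : IsClosed (S : Set (H s →L[ℂ] H s)) :=
    (isClosed_AV s).isClosedEmbedding_subtypeVal.isClosedMap _
      (hcl.preimage (continuous_starAlgHom (retraction s hs)))
  have hle : AV s ≤ S := by
    refine StarSubalgebra.topologicalClosure_minimal (StarAlgebra.adjoin_le ?_) hS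
    rintro T (rfl | ⟨f, rfl⟩)
    · exact ⟨⟨V s, V_mem_AV s⟩, ⟨HS.v s, (shiftRep_v s hs).trans (retraction_V s hs).symm⟩, rfl⟩
    · exact ⟨⟨M s f, M_mem_AV s f⟩, ⟨HS.ι s f, (retraction_M s hs f).symm⟩, rfl⟩
  obtain ⟨b, hb, hba⟩ := hle a.2
  obtain rfl : b = a := Subtype.ext hba
  exact hb

theorem shiftRep_mem_AV (y : HS s) : shiftRep s hs y ∈ AV s := by
  have h : (AV s).comap (shiftRep s hs) = ⊤ := by
    refine CrossedProduct.eq_top_of_isClosed _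
      ((isClosed_AV s).preimage (continuous_starAlgHom (shiftRep s hs))) (fun f => ?_) ?_
    · have h1 := sub_mem (M_mem_AV s f) (orbitCompacts_le_AV s hs
        (sub_retraction_mem s hs ⟨M s f, M_mem_AV s f⟩))
      rw [sub_sub_cancel, retraction_M] at h1
      exact h1
    · change shiftRep s hs (HS.v s) ∈ AV s
      rw [shiftRep_v]
      exact V_mem_AV s
  have hy : y ∈ (AV s).comap (shiftRep s hs) := h ▸ StarSubalgebra.mem_top
  exact hy

theorem retraction_shiftRep (y : HS s) :
    retraction s hs ⟨shiftRep s hs y, shiftRep_mem_AV s hs y⟩ = shiftRep s hs y := by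
  have h : (retraction s hs).comp ((shiftRep s hs).codRestrict (AV s) (shiftRep_mem_AV s hs)) =
      shiftRep s hs := by
    refine CrossedProduct.hom_ext (fun f => ?_) ?_
    · change retraction s hs ⟨shiftRep s hs (HS.ι s f), _⟩ = shiftRep s hs (HS.ι s f)
      have h1 := shiftRep_mem_AV s hs (HS.ι s f)
      simp only [shiftRep_ι] at h1 ⊢
      exact retraction_pointRep s hs _ (fun b hb => positiveCenter_of_ne s hb) f h1
    · change retraction s hs ⟨shiftRep s hs (HS.v s), _⟩ = shiftRep s hs (HS.v s)
      simp only [shiftRep_v]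
      exact retraction_V s hs
  exact congrArg (fun φ : HS s →⋆ₐ[ℂ] (H s →L[ℂ] H s) => φ y) h

theorem retraction_eq_zero_iff (a : AV s) : retraction s hs a = 0 ↔ a.1 ∈ orbitCompacts s := by
  constructor
  · intro h
    have := sub_retraction_mem s hs a
    rwa [h, sub_zero] at this
  · intro h
    obtain ⟨c, hc⟩ := (mem_orbitCompacts_iff s).mp h
    -- W maps into the orbit of (1,1), orthogonal to the zero orbit on which `a` lives; thus neither
    -- summand of the retraction sees `a`.
    have h1 : a.1 * W s hs = 0 := by
      rw [← hc]
      change (J₀ s ∘L c.1 ∘L adjoint (J₀ s)) ∘L (J₁ s hs ∘L adjoint (J₀ s)) = 0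
      rw [comp_assoc, comp_assoc, ← comp_assoc (adjoint (J₀ s)), adjoint_J₀_comp_J₁]
      simp
    have h2 : star (W s hs) * W s hs * a.1 = a.1 := by
      rw [star_W_mul_W, ← hc]
      change (J₀ s ∘L adjoint (J₀ s)) ∘L (J₀ s ∘L c.1 ∘L adjoint (J₀ s)) = J₀ s ∘L c.1 ∘L _
      rw [comp_assoc, ← comp_assoc _ (J₀ s), adjoint_J₀_comp_J₀]
      rfl
    rw [retraction_apply, sub_mul, one_mul, h2, sub_self, mul_assoc, h1, mul_zero, add_zero]

/-- The quotient map `A_V → HS(s)`. -/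
def quotientHom : AV s →⋆ₐ[ℂ] HS s :=
  ((StarAlgEquiv.ofInjective (shiftRep s hs) (shiftRep_injective s hs)).symm :
    (shiftRep s hs).range →⋆ₐ[ℂ] HS s).comp
    ((retraction s hs).codRestrict (shiftRep s hs).range (retraction_mem_range s hs))

theorem shiftRep_quotientHom (a : AV s) : shiftRep s hs (quotientHom s hs a) = retraction s hs a :=
  congrArg Subtype.val ((StarAlgEquiv.ofInjective (shiftRep s hs)
    (shiftRep_injective s hs)).apply_symm_apply ⟨_, retraction_mem_range s hs a⟩)

/-- The embedding `𝒦 → A_V` with `e_{kl} ↦ V^k P_(0,0) V*^l`. -/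
def compactsHom : K →⋆ₙₐ[ℂ] AV s where
  toFun c := ⟨conjHom (J₀ s) (adjoint_J₀_comp_J₀ s) c.1, orbitCompacts_le_AV s hs ⟨c, rfl⟩⟩
  map_smul' c x := Subtype.ext (map_smul _ c x.1)
  map_zero' := Subtype.ext (map_zero _)
  map_add' x y := Subtype.ext (map_add _ x.1 y.1)
  map_mul' x y := Subtype.ext (map_mul _ x.1 y.1)
  map_star' x := Subtype.ext (map_star _ x.1)

end Retraction

end HenselShift

end

/-! ### The short exact sequence -/

theorem theorem5p3 (s : ℕ) [NeZero s] (hs : 2 ≤ s) :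
    ∃ (φ : HenselShift.K →⋆ₙₐ[ℂ] HenselShift.AV s)
      (ψ : HenselShift.AV s →⋆ₐ[ℂ] HenselShift.HS s),
      -- exactness of `0 → 𝒦 → A_V → HS(s) → 0`
      Function.Injective φ ∧
      (∀ a : HenselShift.AV s, ψ a = 0 ↔ a ∈ Set.range φ) ∧
      Function.Surjective ψ ∧
      -- the image of `𝒦` is the ideal `𝓘_V`, generated by the matrix units `V^k P_(0,0) V*^l`
      (∀ T : HenselShift.H s →L[ℂ] HenselShift.H s,
        (∃ c : HenselShift.K, (φ c : HenselShift.H s →L[ℂ] HenselShift.H s) = T) ↔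
          T ∈ HenselShift.IdealV s) ∧
      HenselShift.IdealV s = HenselShift.matrixUnitAlgebra s ∧
      (∀ k l : ℕ, (φ (HenselShift.matrixUnit k l) : HenselShift.H s →L[ℂ] HenselShift.H s) =
        HenselShift.PTilde s k l) ∧
      -- the quotient map on the generators
      (∀ f : C(HenselShift.SAdicInt s, ℂ),
        ψ ⟨HenselShift.M s f, HenselShift.M_mem_AV s f⟩ = HenselShift.HS.ι s f) ∧
      ψ ⟨HenselShift.V s, HenselShift.V_mem_AV s⟩ = HenselShift.HS.v s := by
  open HenselShift in
  refine ⟨compactsHom s hs, quotientHom s hs, fun x y h => ?_, fun a => ?_, fun y => ?_, fun T => ?_,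
    ?_, fun k l => conjHom_matrixUnit s k l, fun f => ?_, ?_⟩
  · exact Subtype.ext (conjHom_injective _ _ (congrArg Subtype.val h))
  · rw [← (shiftRep_injective s hs).eq_iff, shiftRep_quotientHom, map_zero, retraction_eq_zero_iff,
      mem_orbitCompacts_iff]
    exact exists_congr fun c => ⟨fun h => Subtype.ext h, fun h => congrArg Subtype.val h⟩
  -- The image of y under `shiftRep` lies in A_V and is fixed by the retraction, so it is a preimage
  -- of y; this also splits the sequence.
  · refine ⟨⟨shiftRep s hs y, shiftRep_mem_AV s hs y⟩, shiftRep_injective s hs ?_⟩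
    rw [shiftRep_quotientHom, retraction_shiftRep]
  · rw [IdealV_eq]
    exact (mem_orbitCompacts_iff s).symm
  · rw [IdealV_eq, matrixUnitAlgebra_eq]
  · refine shiftRep_injective s hs ?_
    rw [shiftRep_quotientHom, retraction_M]
  · refine shiftRep_injective s hs ?_
    rw [shiftRep_quotientHom, retraction_V, shiftRep_v]
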